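/- Let $\mathbb K$ be an algebraically closed field of arbitrary characteristic and $N\ge 1$. Let $V,W$ be $(N+1)$-dimensional $\mathbb K$-vector spaces in duality, with dual bases $X_0,\dots,X_N$ of $V^*$ and $Y_0,\dots,Y_N$ of $W^*\cong V$ (so that the pairing of $V$ and $W$ is $\sum_i v_iw_i$ in coordinates), and put $R=\operatorname{Sym}(V^*)=\mathbb K[X_0,\dots,X_N]$, $S=\operatorname{Sym}(W^*)=\mathbb K[Y_0,\dots,Y_N]$. Let $Z\subseteq\mathbb P(V)$ be a finite set of points with homogeneous ideal $I(Z)\subseteq R$, and let $\mathcal A_Z=\{P^\perp : P\in Z\}$ be the dual hyperplane arrangement in $\mathbb P(W)$. Let $$D(\mathcal A_Z)=\{\theta\in\operatorname{Der}_{\mathbb K}(S) : \theta(I(H))\subseteq I(H)\text{ for all }H\in\mathcal A_Z\},\qquad D_0(\mathcal A_Z)=D(\mathcal A_Z)/S\theta_e,\qquad \theta_e=\sum_i Y_i\tfrac{\partial}{\partial Y_i},$$ graded by $\deg\theta=\deg\theta(Y_i)$. For a line $L\subseteq\mathbb P(W)$ let $D_0(\mathcal A_Z)|_L=\bigoplus_{d\in\mathbb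 Z}H^0\bigl(L,\widetilde{D_0(\mathcal A_Z)}\otimes\mathcal O_L(d)\bigr)$, a graded $S/I(L)$-module. Let $Q=L^\perp\subseteq\mathbb P(V)$ be the dual subspace of codimension $2$, let $\mathcal F_Q=\operatorname{Sym}_{\mathbb K}([I(Q)]_1)$, which acts on $R$ through $[I(Q)]_1\subseteq R$, and let $I_Q^{\gg}(Z)\subseteq R$ be the $\mathcal F_Q$-submodule $\bigoplus_d\,[I(Z)\cap I(Q)^{d-1}]_d$ (with $I(Q)^{-1}=R$). Then there is a nonempty Zariski open set of lines $L\subseteq\mathbb P(W)$ such that, for each line $L$ in it and each basis $\alpha=(\alpha_1,\dots,\alpha_{N-1})$ of the linear subspace of $V$ that defines $Q$, the following hold. 1. There is an isomorphism of $\mathbb K$-algebras $\tau_Q:S/I(L)\to\mathcal F_Q$ that sends the class of $Y_i$ to the linear form $$M_i=\det\begin{pmatrix}e_i\\ X_0\ \cdots\ X_N\\ \alpha_1\\ \vdots\\ \alpha_{N-1}\end{pmatrix}\in[I(Q)]_1 ,$$ where $e_i$ is the $i$-th standard row vector. 2. There is an isomorphism of $\mathcal F_Q$-modules $$\eta_Q: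 D_0(\mathcal A_Z)|_L\otimes_{S/I(L)}\mathcal F_Q\;\longrightarrow\; I_Q^{\gg}(Z),$$ where $\mathcal F_Q$ is an $S/I(L)$-algebra through $\tau_Q$, such that $$\eta_Q\Bigl(\sum_i f_i\tfrac{\partial}{\partial Y_i}\otimes 1\Bigr)=\sum_i\tau_Q(f_i)X_i$$ for every element of $D_0(\mathcal A_Z)|_L$ that is the class of a derivation $\sum_i f_i\frac{\partial}{\partial Y_i}\in\operatorname{Der}_{\mathbb K}(S,S/I(L))$, modulo multiples of $\theta_e$; if $Z\neq\emptyset$, every element of $D_0(\mathcal A_Z)|_L$ is such a class. 3. $\eta_Q$ is graded with a shift of degree by one: for all $d\in\mathbb Z$ it maps the part of degree $d$ of $D_0(\mathcal A_Z)|_L\otimes\mathcal F_Q$ onto $[I_Q^{\gg}(Z)]_{d+1}$, and $\sigma\mapsto\eta_Q(\sigma\otimes1)$ is a bijection $[D_0(\mathcal A_Z)|_L]_d\to[I(Z)\cap I(Q)^{d}]_{d+1}$ (where $I(Q)^d=R$ for $d<0$). The part of degree $d$ of $I_Q^{\gg}(Z)$ is $[I(Z)\cap I(Q)^{d-1}]_d$.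 -/

import Mathlib

open scoped TensorProduct LinearAlgebra.Projectivization

noncomputable section

namespace PointsAndDerivations

/-! ### Graded modules on a projective scheme: global sections of all twists -/

section Sections

variable {A : Type*} [CommRing A] (N : Type*) [AddCommGroup N] [Module A N]

/-- The restriction map `N_g → N_h` of the sheaf associated with `N`, for `g ∣ h`
(so that `D₊(h) ⊆ D₊(g)`). -/
def restrict (g h : A) (hgh : g ∣ h) :
    LocalizedModule (Submonoid.powers g) N →ₗ[A] LocalizedModule (Submonoid.powers h) N :=
  LocalizedModule.lift (Submonoid.powers g)
    (LocalizedModule.mkLinearMap (Submonoid.powers h) N) (by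
      rintro ⟨x, k, rfl⟩
      have hu := IsLocalizedModule.map_units
        (LocalizedModule.mkLinearMap (Submonoid.powers h) N)
        (⟨h ^ k, k, rfl⟩ : Submonoid.powers h)
      obtain ⟨c, hc⟩ := pow_dvd_pow_of_dvd hgh k
      have h2 : (algebraMap A (Module.End A (LocalizedModule (Submonoid.powers h) N))) (h ^ k)
          = algebraMap A _ (g ^ k) * algebraMap A _ c := by
        rw [← map_mul, ← hc]
      have h3 : Commute (algebraMap A (Module.End A (LocalizedModule (Submonoid.powers h) N)) (g ^ k))
          (algebraMap A _ c) := Algebra.commutes (g ^ k) _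
      exact (h3.isUnit_mul_iff.mp (h2 ▸ hu)).1)

/-- The homogeneous elements of positive degree of a graded ring, with their degrees. They index
the basic open sets `D₊(g)` of `Proj`. -/
structure PosHomogeneous (𝒜 : ℕ → Set A) where
  deg : ℕ
  elt : A
  deg_pos : 0 < deg
  mem : elt ∈ 𝒜 deg

variable {N}

/-- The part of degree `d` of the localization `N_g` of a graded module `N`, where `g` is
homogeneous of degree `e`: the fractions `x / g ^ k` with `x` homogeneous of degree `d + k e`.
This is the module of sections over `D₊(g)` of the `d`-th twist of the sheaf of `N`. -/
def localizedPiece (𝒩 : ℤ → Set N) (g : A) (e : ℕ) (d : ℤ) :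
    Set (LocalizedModule (Submonoid.powers g) N) :=
  {y | ∃ (k : ℕ) (x : N), x ∈ 𝒩 (d + k * e) ∧ y = LocalizedModule.mk x (Submonoid.pow g k)}

/-- `H⁰(Proj A, Ñ(d))`: the families of sections of `Ñ(d)` over all the basic open sets `D₊(g)`
which agree on the intersections `D₊(g) ∩ D₊(h) = D₊(g h)`. -/
def twistSections (𝒜 : ℕ → Set A) (𝒩 : ℤ → Set N) (d : ℤ) :
    Set (∀ p : PosHomogeneous 𝒜, LocalizedModule (Submonoid.powers p.elt) N) :=
  {σ | (∀ p : PosHomogeneous 𝒜, σ p ∈ localizedPiece 𝒩 p.elt p.deg d) ∧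
    ∀ p q : PosHomogeneous 𝒜, restrict N p.elt (p.elt * q.elt) (dvd_mul_right _ _) (σ p) =
      restrict N q.elt (p.elt * q.elt) (dvd_mul_left _ _) (σ q)}

/-- The graded module `Γ_*(Ñ) = ⨁_d H⁰(Proj A, Ñ(d))`, as an internal sum. -/
def sectionModule (𝒜 : ℕ → Set A) (𝒩 : ℤ → Set N) :
    Submodule A (∀ p : PosHomogeneous 𝒜, LocalizedModule (Submonoid.powers p.elt) N) :=
  Submodule.span A (⋃ d : ℤ, twistSections 𝒜 𝒩 d)

end Sections

/-! ### Derivations that preserve a family of ideals -/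

section LogDer

variable (K : Type*) [Field K] {S : Type*} [CommRing S] [Algebra K S]

/-- The module of the `K`-derivations `θ` of `S` with `θ(I) ⊆ I` for all `I` in a family `ℐ` of
ideals. For the ideals of the hyperplanes of an arrangement this is the module `D(𝒜)`. -/
def logDer (ℐ : Set (Ideal S)) : Submodule S (Derivation K S S) where
  carrier := {θ | ∀ I ∈ ℐ, ∀ f ∈ I, θ f ∈ I}
  add_mem' := fun ha hb I hI f hf => add_mem (ha I hI f hf) (hb I hI f hf)
  zero_mem' := fun I _ _ _ => zero_mem I
  smul_mem' := fun c _ hθ I hI f hf => Ideal.mul_mem_left _ c (hθ I hI f hf)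

variable {K}

/-- The quotient of `logDer K ℐ` by the multiples `S ε` of a derivation `ε`. For the Euler
derivation this is the reduced module of derivations `D₀(𝒜) = D(𝒜) / S θ_e`. -/
def RedDer (ℐ : Set (Ideal S)) (ε : Derivation K S S) : Type _ :=
  logDer K ℐ ⧸ (Submodule.span S {ε}).submoduleOf (logDer K ℐ)

instance (ℐ : Set (Ideal S)) (ε : Derivation K S S) : AddCommGroup (RedDer ℐ ε) :=
  inferInstanceAs (AddCommGroup (_ ⧸ (Submodule.span S {ε}).submoduleOf (logDer K ℐ)))

instance (ℐ : Set (Ideal S)) (ε : Derivation K S S) : Module S (RedDer ℐ ε) :=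
  inferInstanceAs (Module S (_ ⧸ (Submodule.span S {ε}).submoduleOf (logDer K ℐ)))

/-- The quotient map `D(𝒜) → D₀(𝒜)`. -/
def RedDer.mk (ℐ : Set (Ideal S)) (ε : Derivation K S S) : logDer K ℐ →ₗ[S] RedDer ℐ ε :=
  Submodule.mkQ _

/-- `M ⊗_S S/I = M / I M`. -/
def ModIdeal (I : Ideal S) (M : Type*) [AddCommGroup M] [Module S M] : Type _ :=
  M ⧸ (I • (⊤ : Submodule S M))

instance (I : Ideal S) (M : Type*) [AddCommGroup M] [Module S M] : AddCommGroup (ModIdeal I M) :=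
  inferInstanceAs (AddCommGroup (M ⧸ (I • (⊤ : Submodule S M))))

instance (I : Ideal S) (M : Type*) [AddCommGroup M] [Module S M] :
    Module (S ⧸ I) (ModIdeal I M) :=
  inferInstanceAs (Module (S ⧸ I) (M ⧸ (I • (⊤ : Submodule S M))))

/-- The quotient map `M → M / I M`. -/
def ModIdeal.mk (I : Ideal S) (M : Type*) [AddCommGroup M] [Module S M] : M →+ ModIdeal I M :=
  (Submodule.mkQ (I • (⊤ : Submodule S M))).toAddMonoidHom

end LogDer

/-! ### Projective spaces in dual coordinates -/

variable {K : Type*} [Field K] {n : ℕ}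

variable (K n) in
/-- The vector spaces `V` and `W`, each written in coordinates with respect to dual bases. -/
abbrev Vec := Fin (n + 2) → K

variable (K n) in
/-- The homogeneous coordinate rings `R = Sym(V*) = K[X₀, …]` and `S = Sym(W*) = K[Y₀, …]`. -/
abbrev Poly := MvPolynomial (Fin (n + 2)) K

/-- The annihilator of a subspace under the pairing of `V` and `W`. -/
def perp (U : Submodule K (Vec K n)) : Submodule K (Vec K n) where
  carrier := {v | ∀ u ∈ U, v ⬝ᵥ u = 0}
  add_mem' := fun ha hb u hu => by rw [add_dotProduct, ha u hu, hb u hu, add_zero]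
  zero_mem' := fun u _ => zero_dotProduct u
  smul_mem' := fun c v hv u hu => by rw [smul_dotProduct, hv u hu, smul_zero]

/-- The homogeneous ideal of a linear subspace. -/
abbrev idealOf (U : Submodule K (Vec K n)) : Ideal (Poly K n) :=
  MvPolynomial.vanishingIdeal K (U : Set (Vec K n))

/-- The homogeneous ideal `I(Z)` of a set of points of projective space (the polynomials that
vanish on the cone over `Z`). -/
def idealOfPoints (Z : Set (ℙ K (Vec K n))) : Ideal (Poly K n) :=
  ⨅ P ∈ Z, idealOf P.submodule

/-- The hyperplane arrangement dual to a set of points. -/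
def dualArrangement (Z : Set (ℙ K (Vec K n))) : Set (Submodule K (Vec K n)) :=
  {H | ∃ P ∈ Z, H = perp P.submodule}

/-- The part of degree `d` of the polynomial ring, for `d : ℤ`. -/
def homogeneousPart : ℤ → Submodule K (Poly K n)
  | Int.ofNat d => MvPolynomial.homogeneousSubmodule (Fin (n + 2)) K d
  | Int.negSucc _ => ⊥

/-- `HoldsForGeneralLine p`: there is a nonempty Zariski open set of lines in `ℙ(W)`, i.e. of
two-dimensional subspaces of `W`, on which `p` holds. The Grassmannian of lines is the open
quotient of the variety of linearly independent pairs of vectors, so such a set is given by the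
nonvanishing of a nonzero polynomial in the coordinates of a pair of spanning vectors. -/
def HoldsForGeneralLine (p : Submodule K (Vec K n) → Prop) : Prop :=
  ∃ G : MvPolynomial (Fin 2 × Fin (n + 2)) K, G ≠ 0 ∧
    ∀ u : Fin 2 → Vec K n, LinearIndependent K u →
      MvPolynomial.eval (fun ij => u ij.1 ij.2) G ≠ 0 → p (Submodule.span K (Set.range u))

/-! ### Derivations of arrangements and their restriction to a line -/

/-- The module `D(𝒜)` of logarithmic derivations of an arrangement. -/
abbrev arrDer (𝒜 : Set (Submodule K (Vec K n))) :
    Submodule (Poly K n) (Derivation K (Poly K n) (Poly K n)) :=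
  logDer K (idealOf '' 𝒜)

variable (K n) in
/-- The Euler derivation `∑ Yᵢ ∂/∂Yᵢ`. -/
def euler : Derivation K (Poly K n) (Poly K n) :=
  MvPolynomial.mkDerivation K MvPolynomial.X

/-- The reduced module of derivations `D₀(𝒜) = D(𝒜) / S θ_e`. -/
abbrev ArrRedDer (𝒜 : Set (Submodule K (Vec K n))) := RedDer (idealOf '' 𝒜) (euler K n)

/-- The homogeneous coordinate ring `S / I(L)`. -/
abbrev CoordRing (L : Submodule K (Vec K n)) := Poly K n ⧸ idealOf L

/-- The grading of `S / I(L)`. -/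
def coordRingPart (L : Submodule K (Vec K n)) (e : ℕ) : Set (CoordRing L) :=
  Ideal.Quotient.mk (idealOf L) '' MvPolynomial.homogeneousSubmodule (Fin (n + 2)) K e

/-- `D₀(𝒜) ⊗_S S/I(L) = D₀(𝒜) / I(L) D₀(𝒜)`, whose sheaf on `L` is the restriction to `L` of the
sheaf of `D₀(𝒜)`. -/
abbrev RedDerMod (𝒜 : Set (Submodule K (Vec K n))) (L : Submodule K (Vec K n)) :=
  ModIdeal (idealOf L) (ArrRedDer 𝒜)

/-- The class of a logarithmic derivation. -/
def derClass (𝒜 : Set (Submodule K (Vec K n))) (L : Submodule K (Vec K n)) (θ : arrDer 𝒜) :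
    RedDerMod 𝒜 L :=
  ModIdeal.mk (idealOf L) (ArrRedDer 𝒜) (RedDer.mk (idealOf '' 𝒜) (euler K n) θ)

/-- The grading by polynomial degree: the classes of the `θ ∈ D(𝒜)` such that all `θ(Yᵢ)` are
homogeneous of degree `d`. -/
def redDerModPart (𝒜 : Set (Submodule K (Vec K n))) (L : Submodule K (Vec K n)) (d : ℤ) :
    Set (RedDerMod 𝒜 L) :=
  derClass 𝒜 L '' {θ | ∀ i, θ.1 (MvPolynomial.X i) ∈ homogeneousPart d}

/-- The restriction `D₀(𝒜)|_L = ⨁_d H⁰(L, D₀(𝒜)~ ⊗ 𝒪_L(d))`, a module over `S / I(L)`. -/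
def RestrictedDer (𝒜 : Set (Submodule K (Vec K n))) (L : Submodule K (Vec K n)) :
    Submodule (CoordRing L) (∀ p : PosHomogeneous (coordRingPart L),
      LocalizedModule (Submonoid.powers p.elt) (RedDerMod 𝒜 L)) :=
  sectionModule (coordRingPart L) (redDerModPart 𝒜 L)

/-- The part `[D₀(𝒜)|_L]_d = H⁰(L, D₀(𝒜)~ ⊗ 𝒪_L(d))`. -/
def restrictedDerPart (𝒜 : Set (Submodule K (Vec K n))) (L : Submodule K (Vec K n)) (d : ℤ) :
    Set (RestrictedDer 𝒜 L) :=
  {σ | σ.1 ∈ twistSections (coordRingPart L) (redDerModPart 𝒜 L) d}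

/-- The section `σ` of `D₀(𝒜)|_L` is the class of the derivation `δ : S → S/I(L)`: over every
`D₊(g)`, if `σ = [θ] / g ^ k` with `θ ∈ D(𝒜)`, then `θ / g ^ k` and `δ` are equal in the
localization at `g` of `Der(S, S/I(L)) / (S/I(L)) θ_e`. -/
def IsClassOf {𝒜 : Set (Submodule K (Vec K n))} {L : Submodule K (Vec K n)}
    (σ : RestrictedDer 𝒜 L) (δ : Derivation K (Poly K n) (CoordRing L)) : Prop :=
  ∀ (p : PosHomogeneous (coordRingPart L)) (θ : arrDer 𝒜) (k : ℕ),
    σ.1 p = LocalizedModule.mk (derClass 𝒜 L θ) (Submonoid.pow p.elt k) →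
    ∃ (c : ℕ) (u : CoordRing L), ∀ f : Poly K n,
      p.elt ^ c * Ideal.Quotient.mk (idealOf L) (θ.1 f) =
        p.elt ^ (c + k) * δ f + u * Ideal.Quotient.mk (idealOf L) (euler K n f)

/-! ### The dual side -/

/-- The linear forms `[I(Q)]₁`. -/
def linearForms (Q : Submodule K (Vec K n)) : Submodule K (Poly K n) :=
  (idealOf Q).restrictScalars K ⊓ MvPolynomial.homogeneousSubmodule (Fin (n + 2)) K 1

/-- The ring `ℱ_Q = Sym([I(Q)]₁)`. -/
abbrev FRing (Q : Submodule K (Vec K n)) := SymmetricAlgebra K (linearForms Q)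

/-- The grading of `ℱ_Q`. -/
def fRingPart (Q : Submodule K (Vec K n)) (e : ℕ) : Submodule K (FRing Q) :=
  LinearMap.range (SymmetricAlgebra.ι K (linearForms Q)) ^ e

/-- `R` is an algebra over `ℱ_Q` through the inclusion `[I(Q)]₁ ⊆ R`. -/
instance fRingAlgebra (Q : Submodule K (Vec K n)) : Algebra (FRing Q) (Poly K n) :=
  (SymmetricAlgebra.lift (linearForms Q).subtype).toRingHom.toAlgebra

/-- `[I(Z) ∩ I(Q)^(d-1)]_d`, where `I(Q)^(-1)` is read as `R`. -/
def dualPart (Z : Set (ℙ K (Vec K n))) (Q : Submodule K (Vec K n)) (d : ℤ) :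
    Submodule K (Poly K n) :=
  (idealOfPoints Z ⊓ idealOf Q ^ (d - 1).toNat).restrictScalars K ⊓ homogeneousPart d

/-- The `ℱ_Q`-submodule `I_Q^≫(Z)` of `R` with the graded pieces `[I(Z) ∩ I(Q)^(d-1)]_d`. -/
def dualModule (Z : Set (ℙ K (Vec K n))) (Q : Submodule K (Vec K n)) :
    Submodule (FRing Q) (Poly K n) :=
  Submodule.span (FRing Q) (⋃ d : ℤ, (dualPart Z Q d : Set (Poly K n)))

/-- The linear form `M_i`: the determinant of the matrix with rows `e_i`, `(X_0, X_1, …)`, and the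
vectors of `α`. -/
def minor (α : Fin n → Vec K n) (i : Fin (n + 2)) : Poly K n :=
  Matrix.det (Matrix.of (Fin.cons (Pi.single i 1) (Fin.cons MvPolynomial.X
    (fun k j => MvPolynomial.C (α k j)))) : Matrix (Fin (n + 2)) (Fin (n + 2)) (Poly K n))

/-- The part of degree `d` of `ℱ_Q ⊗ D₀(𝒜)|_L`, where `ℱ_Q` is an algebra over `S / I(L)`:
the sums of the elements `a ⊗ σ` with `a` and `σ` homogeneous and `deg a + deg σ = d`. -/
def tensorPart (𝒜 : Set (Submodule K (Vec K n))) (L Q : Submodule K (Vec K n))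
    [Algebra (CoordRing L) (FRing Q)] (d : ℤ) :
    AddSubgroup (FRing Q ⊗[CoordRing L] RestrictedDer 𝒜 L) :=
  AddSubgroup.closure {x | ∃ (i : ℕ) (j : ℤ) (a : FRing Q) (σ : RestrictedDer 𝒜 L),
    (i : ℤ) + j = d ∧ a ∈ fRingPart Q i ∧ σ ∈ restrictedDerPart 𝒜 L j ∧ x = a ⊗ₜ σ}

end PointsAndDerivations

end

open scoped TensorProduct LinearAlgebra.Projectivization

noncomputable section

/-! Let `M v` be the vector of the determinants with rows `e_i`, `v` and `α`. This linear map from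
`V` to `W` has image `L`, kernel `Q = L^⊥`, and satisfies `M v ⬝ᵥ v = 0`; nothing else about
determinants enters the duality. Substituting `M` for the coordinates kills exactly `I(L)` and sends
`Y_i` to `M_i`, and the `M_i` span the linear forms vanishing on `Q`. Since `ℱ_Q` embeds in `R`,
this gives `τ_Q`.

A derivation `θ = ∑ f_i ∂/∂Y_i` yields the form `F(v) = ∑ f_i(M v) v_i`, the pairing of `θ` at `M v`
with `v`. The Euler derivation yields `M v ⬝ᵥ v = 0`, and modulo `I(L)` its multiples are the whole
kernel (`exists_of_dualForm_eq_zero`): in the plane `L`, both `θ(M v)` and `M v` are orthogonal to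
`v`, hence proportional. The forms obtained from degree `d ≥ 0` are those of degree `d + 1` in
`I(Q)^d` (`exists_dualForm_eq`). For `P ∈ Z`, the vector `M P` spans the intersection of `L` with
the hyperplane `P^⊥`, and `F(P)` is the value there of `θ(ℓ_P)`, where `ℓ_P` is the equation of
`P^⊥`. So if `θ` is logarithmic, then `F` vanishes on `Z`.

The converse holds locally on `L`. A general line lies in no hyperplane of the arrangement and meets
no intersection of two of them, so near a point of `L` at most one hyperplane matters. If `F(P) =
0`, a correction with coefficient in `I(L)` makes `θ` logarithmic along `P^⊥`, and the equations of
the other hyperplanes are units there (`exists_derForm_eq_of_dualForm`). In the same way a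
logarithmic derivation with components in `I(L)` is locally zero in `D₀ ⊗ S/I(L)`
(`exists_smul_derClassHom_eq_zero`). The Nullstellensatz (`exists_pow_mem`) turns these pointwise
statements into statements about powers of an arbitrary form of positive degree.

Gluing is done inside the fraction field of `R`. A section of a twist has one value there, with a
power of `M(a)` and also a power of `M(b)` as denominator, for two linear forms independent on `L`;
these are coprime, so the value is a polynomial (`exists_sectionModule_embedding`). Its membership
in `I(Z) ∩ I(Q)^d` is checked after multiplication by powers of linear forms
(`mem_dualPart_of_forall`). -/

namespace PointsAndDerivations

/-! ### Duality of subspaces under the dot product -/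

section LinearAlgebra

variable {K : Type*} [Field K] {n : ℕ}

theorem mem_perp {U : Submodule K (Vec K n)} {v : Vec K n} :
    v ∈ perp U ↔ ∀ u ∈ U, v ⬝ᵥ u = 0 := Iff.rfl

theorem dotProductBilin_nondegenerate :
    (dotProductBilin K K : LinearMap.BilinForm K (Vec K n)).Nondegenerate := by
  constructor
  · intro v hv
    ext i
    simpa [dotProductBilin] using hv (Pi.single i 1)
  · intro v hv
    ext i
    simpa [dotProductBilin] using hv (Pi.single i 1)

theorem dotProductBilin_isRefl :
    LinearMap.BilinForm.IsRefl (dotProductBilin K K : LinearMap.BilinForm K (Vec K n)) := by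
  intro v w h
  change w ⬝ᵥ v = 0
  rw [dotProduct_comm]
  exact h

theorem perp_eq_orthogonal (U : Submodule K (Vec K n)) :
    perp U = LinearMap.BilinForm.orthogonal (dotProductBilin K K) U := by
  ext v
  rw [mem_perp, LinearMap.BilinForm.mem_orthogonal_iff]
  refine forall₂_congr fun u _ => ?_
  rw [dotProduct_comm]
  rfl

theorem perp_perp (U : Submodule K (Vec K n)) : perp (perp U) = U := by
  rw [perp_eq_orthogonal, perp_eq_orthogonal]
  exact LinearMap.BilinForm.orthogonal_orthogonal dotProductBilin_nondegenerate
    dotProductBilin_isRefl U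

theorem finrank_perp (U : Submodule K (Vec K n)) :
    Module.finrank K (perp U) = n + 2 - Module.finrank K U := by
  rw [perp_eq_orthogonal, LinearMap.BilinForm.finrank_orthogonal dotProductBilin_nondegenerate]
  simp

theorem mem_perp_span {s : Set (Vec K n)} {v : Vec K n} :
    v ∈ perp (Submodule.span K s) ↔ ∀ u ∈ s, v ⬝ᵥ u = 0 := by
  refine ⟨fun h u hu => h u (Submodule.subset_span hu), fun h u hu => ?_⟩
  induction hu using Submodule.span_induction with
  | mem x hx => exact h x hx
  | zero => simp
  | add x y _ _ hx hy => rw [dotProduct_add, hx, hy, add_zero]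
  | smul c x _ hx => rw [dotProduct_smul, hx, smul_zero]

theorem mem_perp_singleton {a v : Vec K n} :
    v ∈ perp (Submodule.span K {a}) ↔ v ⬝ᵥ a = 0 := by
  rw [mem_perp_span]; simp

theorem exists_dotProduct_eq_one {a : Vec K n} (ha : a ≠ 0) : ∃ c : Vec K n, c ⬝ᵥ a = 1 := by
  obtain ⟨i, hi⟩ := Function.ne_iff.mp ha
  exact ⟨Pi.single i (a i)⁻¹, by simpa using inv_mul_cancel₀ hi⟩

/-- A linear projection of the ambient space onto a subspace. -/
theorem exists_projection (U : Submodule K (Vec K n)) :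
    ∃ π : Vec K n →ₗ[K] Vec K n, (∀ v, π v ∈ U) ∧ ∀ v ∈ U, π v = v := by
  obtain ⟨f, hf⟩ := U.subtype.exists_leftInverse_of_injective U.ker_subtype
  refine ⟨U.subtype ∘ₗ f, fun v => (f v).2, fun v hv => ?_⟩
  have := LinearMap.congr_fun hf ⟨v, hv⟩
  simpa using congrArg Subtype.val this

end LinearAlgebra

/-! ### Linear forms, linear substitutions and ideals of linear subspaces -/

section LinearForms

variable {K : Type*} [Field K] {n : ℕ}

/-- The linear form with a given vector of coefficients. -/
def linForm (c : Vec K n) : Poly K n := ∑ j, MvPolynomial.C (c j) * MvPolynomial.X j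

@[simp]
theorem eval_linForm (c v : Vec K n) : MvPolynomial.eval v (linForm c) = c ⬝ᵥ v := by
  simp [linForm, dotProduct]

theorem isHomogeneous_linForm (c : Vec K n) : (linForm c).IsHomogeneous 1 :=
  MvPolynomial.IsHomogeneous.sum _ _ _ fun j _ => MvPolynomial.isHomogeneous_C_mul_X _ j

theorem exists_eq_linForm {f : Poly K n} (hf : f.IsHomogeneous 1) : ∃ c, f = linForm c := by
  have h : f ∈ MvPolynomial.homogeneousSubmodule (Fin (n + 2)) K 1 := hf
  rw [MvPolynomial.homogeneousSubmodule_one_eq_span_X, Submodule.mem_span_range_iff_exists_fun] at h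
  obtain ⟨c, hc⟩ := h
  exact ⟨c, by rw [← hc, linForm]; simp [MvPolynomial.smul_eq_C_mul]⟩

theorem linForm_ne_zero {c : Vec K n} (hc : c ≠ 0) : linForm c ≠ 0 := by
  intro h
  obtain ⟨d, hd⟩ := exists_dotProduct_eq_one hc
  have := congrArg (MvPolynomial.eval d) h
  rw [eval_linForm, dotProduct_comm, hd, map_zero] at this
  exact one_ne_zero this

theorem mem_idealOf {U : Submodule K (Vec K n)} {f : Poly K n} :
    f ∈ idealOf U ↔ ∀ x ∈ U, MvPolynomial.eval x f = 0 := Iff.rfl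

theorem linForm_mem_idealOf {U : Submodule K (Vec K n)} {c : Vec K n} :
    linForm c ∈ idealOf U ↔ c ∈ perp U := by
  rw [mem_idealOf, mem_perp]
  simp

/-- Composition of polynomial functions with a linear map. -/
def subst (T : Vec K n →ₗ[K] Vec K n) : Poly K n →ₐ[K] Poly K n :=
  MvPolynomial.aeval fun i => linForm fun j => T (Pi.single j 1) i

theorem subst_X (T : Vec K n →ₗ[K] Vec K n) (i : Fin (n + 2)) :
    subst T (MvPolynomial.X i) = linForm fun j => T (Pi.single j 1) i := by
  simp [subst]

@[simp]
theorem eval_subst (T : Vec K n →ₗ[K] Vec K n) (v : Vec K n) (f : Poly K n) :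
    MvPolynomial.eval v (subst T f) = MvPolynomial.eval (T v) f := by
  have h : (MvPolynomial.aeval v : Poly K n →ₐ[K] K).comp (subst T) =
      MvPolynomial.aeval (T v) := by
    refine MvPolynomial.algHom_ext fun i => ?_
    rw [AlgHom.comp_apply, subst_X, MvPolynomial.aeval_X, MvPolynomial.aeval_eq_eval,
      eval_linForm]
    conv_rhs => rw [pi_eq_sum_univ' v, map_sum]
    simp [dotProduct, mul_comm]
  exact AlgHom.congr_fun h f

theorem isHomogeneous_subst (T : Vec K n →ₗ[K] Vec K n) {f : Poly K n} {d : ℕ}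
    (hf : f.IsHomogeneous d) : (subst T f).IsHomogeneous d := by
  have := MvPolynomial.IsHomogeneous.aeval hf (fun i => linForm fun j => T (Pi.single j 1) i)
    (fun i => isHomogeneous_linForm _)
  simpa [subst] using this

theorem linForm_smul (r : K) (c : Vec K n) : linForm (r • c) = MvPolynomial.C r * linForm c := by
  simp [linForm, Finset.mul_sum, mul_assoc]

/-- A polynomial is congruent to its composition with a projection `π`, modulo the linear forms
that vanish on the image of `π`. -/
theorem sub_subst_mem_span (T : Vec K n →ₗ[K] Vec K n) (f : Poly K n) :
    f - subst T f ∈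
      Ideal.span (Set.range fun i => MvPolynomial.X i - subst T (MvPolynomial.X i)) := by
  set J := Ideal.span (Set.range fun i => (MvPolynomial.X i : Poly K n) - subst T (MvPolynomial.X i))
  have h : (Ideal.Quotient.mkₐ K J) = (Ideal.Quotient.mkₐ K J).comp (subst T) := by
    refine MvPolynomial.algHom_ext fun i => ?_
    rw [AlgHom.comp_apply, Ideal.Quotient.mkₐ_eq_mk, Ideal.Quotient.mk_eq_mk_iff_sub_mem]
    exact Ideal.subset_span ⟨i, rfl⟩
  have := AlgHom.congr_fun h f
  rwa [AlgHom.comp_apply, Ideal.Quotient.mkₐ_eq_mk, Ideal.Quotient.mk_eq_mk_iff_sub_mem] at this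

/-- A polynomial that vanishes on the intersection of a subspace `L` with a hyperplane that does
not contain `L` is the sum of one that vanishes on `L` and one that vanishes on the hyperplane. -/
theorem exists_sub_mem_idealOf {L : Submodule K (Vec K n)} {a u : Vec K n} (hu : u ∈ L)
    (hua : u ⬝ᵥ a = 1) {h : Poly K n}
    (hh : ∀ x ∈ L, x ⬝ᵥ a = 0 → MvPolynomial.eval x h = 0) :
    ∃ b ∈ idealOf L, h - b ∈ idealOf (perp (Submodule.span K {a})) := by
  -- The projection along `u` onto the hyperplane of `a`. It maps `L` into itself and fixes the
  -- hyperplane, so `b = h ∘ π` vanishes on `L` and agrees with `h` on the hyperplane.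
  let π : Vec K n →ₗ[K] Vec K n := LinearMap.id - (dotProductBilin K K a).smulRight u
  have hπ : ∀ x, π x = x - (a ⬝ᵥ x) • u := fun x => rfl
  refine ⟨subst π h, fun x hx => ?_, fun x hx => ?_⟩
  · change MvPolynomial.eval _ _ = _
    rw [eval_subst]
    refine hh _ ?_ ?_
    · rw [hπ]; exact L.sub_mem hx (L.smul_mem _ hu)
    · rw [hπ, sub_dotProduct, smul_dotProduct, hua, dotProduct_comm]; simp
  · change MvPolynomial.eval _ _ = _
    have : a ⬝ᵥ x = 0 := by rw [dotProduct_comm]; exact mem_perp_singleton.mp hx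
    rw [map_sub, eval_subst, hπ, this, zero_smul, sub_zero, sub_self]

variable [Infinite K]

theorem subst_eq_zero_iff {T : Vec K n →ₗ[K] Vec K n} {U : Submodule K (Vec K n)}
    (hT : LinearMap.range T = U) {f : Poly K n} : subst T f = 0 ↔ f ∈ idealOf U := by
  subst hT
  constructor
  · rintro h _ ⟨v, rfl⟩
    change MvPolynomial.eval _ _ = _
    rw [← eval_subst, h, map_zero]
  · intro h
    refine MvPolynomial.funext fun v => ?_
    rw [eval_subst, map_zero]
    exact h _ ⟨v, rfl⟩

/-- Composition with a projection onto `U` is an endomorphism of the domain `R` with this ideal as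
kernel. -/
instance isPrime_idealOf (U : Submodule K (Vec K n)) : (idealOf U).IsPrime := by
  obtain ⟨π, h1, h2⟩ := exists_projection U
  have hr : LinearMap.range π = U :=
    le_antisymm (by rintro _ ⟨v, rfl⟩; exact h1 v) fun v hv => ⟨v, h2 v hv⟩
  have : idealOf U = RingHom.ker (subst π) := by
    ext f
    rw [RingHom.mem_ker, subst_eq_zero_iff hr]
  rw [this]
  exact RingHom.ker_isPrime _

/-- The ideal of a linear subspace is generated by linear forms. -/
theorem idealOf_eq_span (U : Submodule K (Vec K n)) :
    idealOf U = Ideal.span (linForm '' (perp U : Set (Vec K n))) := by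
  refine le_antisymm (fun f hf => ?_) (Ideal.span_le.mpr ?_)
  · obtain ⟨π, h1, h2⟩ := exists_projection U
    have hr : LinearMap.range π = U :=
      le_antisymm (by rintro _ ⟨v, rfl⟩; exact h1 v) fun v hv => ⟨v, h2 v hv⟩
    -- As `f` vanishes on the image of `π`, the composition `f ∘ π` is zero and `f` equals its own
    -- difference from it.
    have h := sub_subst_mem_span π f
    rw [(subst_eq_zero_iff hr).mpr hf, sub_zero] at h
    refine Ideal.span_mono ?_ h
    rintro _ ⟨i, rfl⟩
    have h1 : (MvPolynomial.X i - subst π (MvPolynomial.X i)).IsHomogeneous 1 :=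
      (MvPolynomial.isHomogeneous_X K i).sub (isHomogeneous_subst π (MvPolynomial.isHomogeneous_X K i))
    obtain ⟨c, hc⟩ := exists_eq_linForm h1
    refine ⟨c, linForm_mem_idealOf.mp ?_, hc.symm⟩
    rw [← hc, mem_idealOf]
    intro x hx
    simp [h2 x hx]
  · rintro _ ⟨c, hc, rfl⟩
    exact linForm_mem_idealOf.mpr hc

theorem idealOf_perp_singleton (a : Vec K n) :
    idealOf (perp (Submodule.span K {a})) = Ideal.span {linForm a} := by
  rw [idealOf_eq_span, perp_perp]
  refine le_antisymm (Ideal.span_le.mpr ?_) (Ideal.span_mono ?_)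
  · rintro _ ⟨c, hc, rfl⟩
    obtain ⟨r, rfl⟩ := Submodule.mem_span_singleton.mp hc
    rw [linForm_smul]
    exact Ideal.mul_mem_left _ _ (Ideal.subset_span rfl)
  · rintro _ rfl
    exact ⟨a, Submodule.mem_span_singleton_self a, rfl⟩

theorem prime_linForm {a : Vec K n} (ha : a ≠ 0) : Prime (linForm a) := by
  rw [← Ideal.span_singleton_prime (linForm_ne_zero ha), ← idealOf_perp_singleton]
  infer_instance

end LinearForms

/-! ### The map given by the maximal minors, and the isomorphism of coordinate rings -/

section MinorMap

variable {K : Type*} [Field K] {n : ℕ}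

/-- The linear map `V → W` that sends `v` to the vector of the determinants with rows `e_i`, `v`
and the vectors of `α`. -/
def minorMap (α : Fin n → Vec K n) : Vec K n →ₗ[K] Vec K n where
  toFun v i := ((Matrix.detRowAlternating (R := K)).curryLeft (Pi.single i 1)).curryLeft v α
  map_add' v w := by ext i; simp only [map_add, AlternatingMap.add_apply, Pi.add_apply]
  map_smul' c v := by
    ext i; simp only [map_smul, AlternatingMap.smul_apply, Pi.smul_apply, RingHom.id_apply]

/-- The determinant is linear in its first row. All orthogonality relations of `minorMap` then come
from determinants with a repeated row. -/
theorem minorMap_dotProduct (α : Fin n → Vec K n) (v w : Vec K n) :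
    minorMap α v ⬝ᵥ w = Matrix.det (Matrix.of (Matrix.vecCons w (Matrix.vecCons v α))) := by
  have h : Matrix.det (Matrix.of (Matrix.vecCons w (Matrix.vecCons v α))) =
      ((Matrix.detRowAlternating (R := K)).curryLeft w).curryLeft v α := rfl
  have h2 : ∀ i, minorMap α v i =
      ((Matrix.detRowAlternating (R := K)).curryLeft (Pi.single i 1)).curryLeft v α :=
    fun i => rfl
  let D : Vec K n →ₗ[K] K :=
    { toFun := fun w => (Matrix.detRowAlternating (R := K)).curryLeft w (Matrix.vecCons v α)
      map_add' := fun x y => by rw [map_add, AlternatingMap.add_apply]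
      map_smul' := fun c x => by rw [map_smul, AlternatingMap.smul_apply, RingHom.id_apply] }
  have h3 : ∀ w : Vec K n,
      ((Matrix.detRowAlternating (R := K)).curryLeft w).curryLeft v α = D w := fun w => rfl
  rw [h, h3]
  conv_rhs => rw [pi_eq_sum_univ' w, map_sum]
  refine Finset.sum_congr rfl fun i _ => ?_
  rw [map_smul, ← h3, ← h2, smul_eq_mul, mul_comm]

theorem minorMap_dotProduct_self (α : Fin n → Vec K n) (v : Vec K n) :
    minorMap α v ⬝ᵥ v = 0 := by
  rw [minorMap_dotProduct]
  exact Matrix.det_zero_of_row_eq (i := 0) (j := 1) (by simp) rfl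

theorem minorMap_dotProduct_apply (α : Fin n → Vec K n) (v : Vec K n) (k : Fin n) :
    minorMap α v ⬝ᵥ α k = 0 := by
  rw [minorMap_dotProduct]
  refine Matrix.det_zero_of_row_eq (i := 0) (j := k.succ.succ) (Fin.succ_ne_zero _).symm ?_
  ext j
  simp

theorem minorMap_apply_of_mem (α : Fin n → Vec K n) (k : Fin n) :
    minorMap α (α k) = 0 := by
  refine dotProduct_eq_zero _ fun w => ?_
  rw [minorMap_dotProduct]
  refine Matrix.det_zero_of_row_eq (i := 1) (j := k.succ.succ)
    (by simp [Fin.ext_iff]) ?_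
  ext j
  simp

/-- If `v` were outside the span of `α`, then `v` and `α` could be completed by some `w` to a basis,
whose nonzero determinant is the pairing of `minorMap α v` with `w`. -/
theorem ker_minorMap {α : Fin n → Vec K n} (hα : LinearIndependent K α) :
    LinearMap.ker (minorMap α) = Submodule.span K (Set.range α) := by
  refine le_antisymm (fun v hv => ?_) (Submodule.span_le.mpr ?_)
  · by_contra hvα
    have h1 : LinearIndependent K (Matrix.vecCons v α) :=
      linearIndependent_finCons.mpr ⟨hα, hvα⟩
    obtain ⟨w, hw⟩ : ∃ w, w ∉ Submodule.span K (Set.range (Matrix.vecCons v α)) := by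
      by_contra! h
      have h2 := finrank_span_eq_card h1
      rw [(Submodule.eq_top_iff'.mpr h), finrank_top] at h2
      simp at h2
    have h2 : LinearIndependent K (Matrix.vecCons w (Matrix.vecCons v α)) :=
      linearIndependent_finCons.mpr ⟨h1, hw⟩
    have h3 := Matrix.linearIndependent_rows_iff_isUnit
      (A := Matrix.of (Matrix.vecCons w (Matrix.vecCons v α))) |>.mp h2
    have h4 := minorMap_dotProduct α v w
    rw [LinearMap.mem_ker.mp hv, zero_dotProduct] at h4
    exact ((Matrix.isUnit_iff_isUnit_det _).mp h3).ne_zero h4.symm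
  · rintro _ ⟨k, rfl⟩
    exact minorMap_apply_of_mem α k

/-- The properties of the map `minorMap α`, for a basis `α` of the annihilator of a line `L`. -/
structure IsMinorMap (L : Submodule K (Vec K n)) (M : Vec K n →ₗ[K] Vec K n) : Prop where
  range_eq : LinearMap.range M = L
  ker_eq : LinearMap.ker M = perp L
  dot_self : ∀ v, M v ⬝ᵥ v = 0

/-- The values are orthogonal to `α`, so they lie in `L^⊥⊥ = L`; the kernel has dimension `n`, so
the image has dimension two and is all of `L`. -/
theorem isMinorMap_minorMap {L : Submodule K (Vec K n)} (hL : Module.finrank K L = 2)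
    {α : Fin n → Vec K n} (hα : Submodule.span K (Set.range α) = perp L) :
    IsMinorMap L (minorMap α) := by
  have hfin : Module.finrank K (perp L) = n := by rw [finrank_perp, hL]; rfl
  have hind : LinearIndependent K α := by
    rw [linearIndependent_iff_card_eq_finrank_span, Set.finrank, hα, hfin, Fintype.card_fin]
  have hker : LinearMap.ker (minorMap α) = perp L := by rw [ker_minorMap hind, hα]
  refine ⟨?_, hker, minorMap_dotProduct_self α⟩
  refine Submodule.eq_of_le_of_finrank_eq ?_ ?_
  · rintro _ ⟨v, rfl⟩
    rw [← perp_perp L, ← hα, mem_perp_span]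
    rintro _ ⟨k, rfl⟩
    exact minorMap_dotProduct_apply α v k
  · have := (minorMap α).finrank_range_add_finrank_ker
    rw [hker, hfin, Module.finrank_fin_fun] at this
    rw [hL]
    omega

namespace IsMinorMap

variable {L : Submodule K (Vec K n)} {M : Vec K n →ₗ[K] Vec K n}

theorem mem (hM : IsMinorMap L M) (v : Vec K n) : M v ∈ L := hM.range_eq ▸ ⟨v, rfl⟩

theorem exists_eq (hM : IsMinorMap L M) {w : Vec K n} (hw : w ∈ L) : ∃ v, M v = w := by
  rwa [← hM.range_eq] at hw

theorem eq_zero_iff (hM : IsMinorMap L M) {v : Vec K n} : M v = 0 ↔ v ∈ perp L := by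
  rw [← hM.ker_eq, LinearMap.mem_ker]

theorem dot_swap (hM : IsMinorMap L M) (v w : Vec K n) : M v ⬝ᵥ w = -(M w ⬝ᵥ v) := by
  have h := hM.dot_self (v + w)
  rw [map_add, add_dotProduct, dotProduct_add, dotProduct_add, hM.dot_self, hM.dot_self] at h
  linear_combination h

/-- The map `M` is skew. Every vector of `L` is a value of `M`, so this writes each linear form
vanishing on `Q` as a combination of the `M_i`. -/
theorem linForm_apply (hM : IsMinorMap L M) [Infinite K] (w : Vec K n) :
    linForm (M w) = -∑ i, MvPolynomial.C (w i) * subst M (MvPolynomial.X i) := by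
  refine MvPolynomial.funext fun v => ?_
  rw [eval_linForm, hM.dot_swap]
  simp [dotProduct, mul_comm]

theorem subst_X_mem (hM : IsMinorMap L M) (i : Fin (n + 2)) :
    subst M (MvPolynomial.X i) ∈ linearForms (perp L) := by
  refine ⟨fun x hx => ?_, isHomogeneous_subst M (MvPolynomial.isHomogeneous_X K i)⟩
  change MvPolynomial.eval _ _ = _
  rw [eval_subst, hM.eq_zero_iff.mpr hx]
  simp

theorem linearForms_eq (hM : IsMinorMap L M) [Infinite K] :
    linearForms (perp L) = Submodule.span K (Set.range fun i => subst M (MvPolynomial.X i)) := by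
  refine le_antisymm ?_ (Submodule.span_le.mpr ?_)
  · rintro f ⟨hf1, hf2⟩
    obtain ⟨c, rfl⟩ := exists_eq_linForm hf2
    have hc : c ∈ L := by
      rw [← perp_perp L]
      exact linForm_mem_idealOf.mp hf1
    obtain ⟨w, rfl⟩ := hM.exists_eq hc
    rw [hM.linForm_apply]
    refine Submodule.neg_mem _ (Submodule.sum_mem _ fun i _ => ?_)
    rw [← MvPolynomial.smul_eq_C_mul]
    exact Submodule.smul_mem _ _ (Submodule.subset_span ⟨i, rfl⟩)
  · rintro _ ⟨i, rfl⟩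
    exact hM.subst_X_mem i

theorem idealOf_perp_eq (hM : IsMinorMap L M) [Infinite K] :
    idealOf (perp L) = Ideal.span (Set.range fun i => subst M (MvPolynomial.X i)) := by
  refine le_antisymm ?_ (Ideal.span_le.mpr ?_)
  · rw [idealOf_eq_span, perp_perp]
    refine Ideal.span_le.mpr ?_
    rintro _ ⟨c, hc, rfl⟩
    obtain ⟨w, rfl⟩ := hM.exists_eq hc
    rw [hM.linForm_apply]
    exact neg_mem (sum_mem fun i _ => Ideal.mul_mem_left _ _ (Ideal.subset_span ⟨i, rfl⟩))
  · rintro _ ⟨i, rfl⟩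
    exact (hM.subst_X_mem i).1

end IsMinorMap

theorem eval_minor (α : Fin n → Vec K n) (i : Fin (n + 2)) (v : Vec K n) :
    MvPolynomial.eval v (minor α i) = minorMap α v i := by
  rw [minor, RingHom.map_det]
  change _ = Matrix.det (Matrix.of (Matrix.vecCons (Pi.single i 1) (Matrix.vecCons v α)))
  congr 1
  ext r j
  refine Fin.cases ?_ (fun r => Fin.cases ?_ (fun k => ?_) r) r
  · simp [Pi.single_apply, apply_ite]
  · simp
  · simp

theorem subst_minorMap_X [Infinite K] (α : Fin n → Vec K n) (i : Fin (n + 2)) :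
    subst (minorMap α) (MvPolynomial.X i) = minor α i := by
  refine MvPolynomial.funext fun v => ?_
  rw [eval_subst, eval_minor, MvPolynomial.eval_X]

theorem algebraMap_FRing_ι (Q : Submodule K (Vec K n)) (x : linearForms Q) :
    algebraMap (FRing Q) (Poly K n) (SymmetricAlgebra.ι K (linearForms Q) x) = x :=
  SymmetricAlgebra.lift_ι_apply _ _

/-- A linear projection `p` onto the subspace of linear forms, extended multiplicatively from the
variables, is a retraction. Identities in `ℱ_Q` can therefore be checked in `R`. -/
theorem algebraMap_FRing_injective (Q : Submodule K (Vec K n)) :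
    Function.Injective (algebraMap (FRing Q) (Poly K n)) := by
  obtain ⟨p, hp⟩ := (linearForms Q).subtype.exists_leftInverse_of_injective
    (linearForms Q).ker_subtype
  let g : Poly K n →ₐ[K] FRing Q :=
    MvPolynomial.aeval fun i => SymmetricAlgebra.ι K (linearForms Q) (p (MvPolynomial.X i))
  have hg : ∀ c, g (linForm c) = SymmetricAlgebra.ι K (linearForms Q) (p (linForm c)) := by
    intro c
    simp [linForm, ← MvPolynomial.smul_eq_C_mul, g]
  have h : g.comp (SymmetricAlgebra.lift (linearForms Q).subtype) = AlgHom.id K _ := by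
    refine SymmetricAlgebra.algHom_ext (LinearMap.ext fun x => ?_)
    have h1 : p x = x := LinearMap.congr_fun hp x
    obtain ⟨c, hc⟩ := exists_eq_linForm x.2.2
    have h2 := hg c
    rw [← hc, h1] at h2
    simpa using h2
  exact Function.LeftInverse.injective (g := g) fun x => AlgHom.congr_fun h x

namespace IsMinorMap

variable {L : Submodule K (Vec K n)} {M : Vec K n →ₗ[K] Vec K n}

/-- The homomorphism `S → ℱ_Q` that sends the coordinates to the linear forms of `M`. -/
def polyHom (hM : IsMinorMap L M) : Poly K n →ₐ[K] FRing (perp L) :=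
  MvPolynomial.aeval fun i => SymmetricAlgebra.ι K (linearForms (perp L)) ⟨_, hM.subst_X_mem i⟩

theorem algebraMap_polyHom (hM : IsMinorMap L M) (f : Poly K n) :
    algebraMap (FRing (perp L)) (Poly K n) (hM.polyHom f) = subst M f := by
  have h : (SymmetricAlgebra.lift (linearForms (perp L)).subtype).comp hM.polyHom = subst M := by
    refine MvPolynomial.algHom_ext fun i => ?_
    rw [AlgHom.comp_apply, polyHom, MvPolynomial.aeval_X]
    exact SymmetricAlgebra.lift_ι_apply _ _
  exact AlgHom.congr_fun h f

theorem polyHom_eq_zero_iff (hM : IsMinorMap L M) [Infinite K] {f : Poly K n} :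
    hM.polyHom f = 0 ↔ f ∈ idealOf L := by
  rw [← subst_eq_zero_iff hM.range_eq, ← hM.algebraMap_polyHom,
    map_eq_zero_iff _ (algebraMap_FRing_injective _)]

theorem polyHom_surjective (hM : IsMinorMap L M) [Infinite K] :
    Function.Surjective hM.polyHom := by
  intro a
  rw [← AlgHom.mem_range]
  induction a using SymmetricAlgebra.induction with
  | algebraMap r => exact Subalgebra.algebraMap_mem _ r
  | ι x =>
    obtain ⟨x, hx⟩ := x
    have hx' := hx
    rw [hM.linearForms_eq, Submodule.mem_span_range_iff_exists_fun] at hx'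
    obtain ⟨c, hc⟩ := hx'
    refine ⟨∑ i, c i • MvPolynomial.X i, algebraMap_FRing_injective _ ?_⟩
    change algebraMap (FRing (perp L)) (Poly K n) (hM.polyHom _) = _
    rw [algebraMap_polyHom, algebraMap_FRing_ι]
    simp [← hc]
  | mul a b ha hb => exact mul_mem ha hb
  | add a b ha hb => exact add_mem ha hb

/-- The isomorphism `S/I(L) ≅ ℱ_Q`. -/
def coordEquiv (hM : IsMinorMap L M) [Infinite K] : CoordRing L ≃ₐ[K] FRing (perp L) :=
  AlgEquiv.ofBijective
    (Ideal.Quotient.liftₐ (idealOf L) hM.polyHom fun _ hf => hM.polyHom_eq_zero_iff.mpr hf) <| by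
    constructor
    · rw [injective_iff_map_eq_zero]
      intro x hx
      obtain ⟨f, rfl⟩ := Ideal.Quotient.mk_surjective x
      exact Ideal.Quotient.eq_zero_iff_mem.mpr (hM.polyHom_eq_zero_iff.mp hx)
    · intro a
      obtain ⟨f, rfl⟩ := hM.polyHom_surjective a
      exact ⟨Ideal.Quotient.mk _ f, rfl⟩

theorem algebraMap_coordEquiv_mk (hM : IsMinorMap L M) [Infinite K] (f : Poly K n) :
    algebraMap (FRing (perp L)) (Poly K n) (hM.coordEquiv (Ideal.Quotient.mk _ f)) = subst M f :=
  hM.algebraMap_polyHom f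

end IsMinorMap

end MinorMap

/-! ### Sections of the twists as elements of a fraction field -/

section SectionValues

variable {A : Type*} [CommRing A] {N : Type*} [AddCommGroup N] [Module A N]
  {B : Type*} [CommRing B] [Algebra A B] [FaithfulSMul A B]

theorem algebraMap_fractionRing_ne_zero {g : A} (hg : g ≠ 0) :
    algebraMap A (FractionRing B) g ≠ 0 := by
  rw [IsScalarTower.algebraMap_apply A B (FractionRing B)]
  exact (map_ne_zero_iff _ (IsFractionRing.injective B (FractionRing B))).mpr
    ((map_ne_zero_iff _ (FaithfulSMul.algebraMap_injective A B)).mpr hg)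

variable [IsDomain B]

/-- The extension of a linear map `N → B` to a map from `N_g` to the fraction field of `B`. -/
def localValue (ψ : N →ₗ[A] B) (g : A) (hg : g ≠ 0) :
    LocalizedModule (Submonoid.powers g) N →ₗ[A] FractionRing B :=
  LocalizedModule.lift (Submonoid.powers g)
    ((IsScalarTower.toAlgHom A B (FractionRing B)).toLinearMap ∘ₗ ψ) (by
      rintro ⟨x, k, rfl⟩
      have h : algebraMap A (FractionRing B) (g ^ k) ≠ 0 := by
        rw [map_pow]; exact pow_ne_zero k (algebraMap_fractionRing_ne_zero hg)
      rw [Module.End.isUnit_iff]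
      refine ⟨fun a b hab => ?_, fun b => ⟨(algebraMap A (FractionRing B) (g ^ k))⁻¹ * b, ?_⟩⟩
      · simp only [Module.algebraMap_end_apply, Algebra.smul_def] at hab
        exact mul_left_cancel₀ h hab
      · simp only [Module.algebraMap_end_apply, Algebra.smul_def]
        exact mul_inv_cancel_left₀ h b)

theorem pow_smul_localValue_mk (ψ : N →ₗ[A] B) (g : A) (hg : g ≠ 0) (x : N) (k : ℕ) :
    g ^ k • localValue ψ g hg (LocalizedModule.mk x (Submonoid.pow g k)) =
      algebraMap B (FractionRing B) (ψ x) := by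
  rw [← map_smul]
  have h : g ^ k • LocalizedModule.mk x (Submonoid.pow g k) =
      (LocalizedModule.mk x 1 : LocalizedModule (Submonoid.powers g) N) := by
    rw [LocalizedModule.smul'_mk]
    exact LocalizedModule.mk_cancel (Submonoid.pow g k) x
  rw [h, localValue, LocalizedModule.lift_mk_one]
  rfl

theorem eq_of_pow_smul_eq {g : A} (hg : g ≠ 0) {k : ℕ} {x y : FractionRing B}
    (h : g ^ k • x = g ^ k • y) : x = y := by
  rw [Algebra.smul_def, Algebra.smul_def, map_pow] at h
  exact mul_left_cancel₀ (pow_ne_zero k (algebraMap_fractionRing_ne_zero hg)) h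

theorem exists_eq_mk (g : A) (y : LocalizedModule (Submonoid.powers g) N) :
    ∃ (x : N) (k : ℕ), y = LocalizedModule.mk x (Submonoid.pow g k) := by
  induction y using LocalizedModule.induction_on with
  | h m s =>
    obtain ⟨_, k, rfl⟩ := s
    exact ⟨m, k, rfl⟩

theorem restrict_mk_one (g h : A) (hgh : g ∣ h) (x : N) :
    restrict N g h hgh (LocalizedModule.mk x 1) = LocalizedModule.mk x 1 := by
  rw [restrict, LocalizedModule.lift_mk_one]
  rfl

theorem localValue_restrict (ψ : N →ₗ[A] B) (g h : A) (hgh : g ∣ h) (hg : g ≠ 0) (hh : h ≠ 0)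
    (y : LocalizedModule (Submonoid.powers g) N) :
    localValue ψ h hh (restrict N g h hgh y) = localValue ψ g hg y := by
  obtain ⟨x, k, rfl⟩ := exists_eq_mk g y
  refine eq_of_pow_smul_eq hg (k := k) ?_
  rw [pow_smul_localValue_mk, ← map_smul, ← map_smul]
  have h1 : g ^ k • LocalizedModule.mk x (Submonoid.pow g k) =
      (LocalizedModule.mk x 1 : LocalizedModule (Submonoid.powers g) N) := by
    rw [LocalizedModule.smul'_mk]
    exact LocalizedModule.mk_cancel (Submonoid.pow g k) x
  rw [h1, restrict_mk_one, localValue, LocalizedModule.lift_mk_one]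
  rfl

/-- The elements killed by `ψ` are `g`-power torsion, which localization at `g` already removes. -/
theorem localValue_injective (ψ : N →ₗ[A] B) (g : A) (hg : g ≠ 0)
    (hψ : ∀ x, ψ x = 0 → ∃ c : ℕ, g ^ c • x = 0) : Function.Injective (localValue ψ g hg) := by
  rw [injective_iff_map_eq_zero]
  intro y hy
  obtain ⟨x, k, rfl⟩ := exists_eq_mk g y
  have h := pow_smul_localValue_mk ψ g hg x k
  rw [hy, smul_zero, eq_comm, map_eq_zero_iff _ (IsFractionRing.injective B (FractionRing B))] at h
  obtain ⟨c, hc⟩ := hψ x h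
  rw [← LocalizedModule.zero_mk (Submonoid.pow g k), LocalizedModule.mk_eq]
  refine ⟨Submonoid.pow g c, ?_⟩
  rw [smul_comm, smul_zero, smul_zero]
  have : Submonoid.pow g c • x = 0 := hc
  rw [this, smul_zero]

/-- Two nonempty basic open sets of an integral scheme overlap: `A` embeds in a domain, so the
product of the two elements is nonzero, and compatible sections have the same value over it. Sums of
sections of different degrees follow by linearity. -/
theorem localValue_eq_of_mem_sectionModule {𝒜 : ℕ → Set A} {𝒩 : ℤ → Set N} (ψ : N →ₗ[A] B)
    {σ : ∀ p : PosHomogeneous 𝒜, LocalizedModule (Submonoid.powers p.elt) N}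
    (hσ : σ ∈ sectionModule 𝒜 𝒩) (p q : PosHomogeneous 𝒜) (hp : p.elt ≠ 0) (hq : q.elt ≠ 0) :
    localValue ψ p.elt hp (σ p) = localValue ψ q.elt hq (σ q) := by
  have : IsDomain A := (FaithfulSMul.algebraMap_injective A B).isDomain
  induction hσ using Submodule.span_induction with
  | mem σ h =>
    obtain ⟨d, hd⟩ := Set.mem_iUnion.mp h
    have h1 := hd.2 p q
    rw [← localValue_restrict ψ p.elt (p.elt * q.elt) (dvd_mul_right _ _) hp (mul_ne_zero hp hq),
      h1, localValue_restrict ψ q.elt _ _ hq]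
  | zero => simp
  | add x y _ _ hx hy => simp only [Pi.add_apply, map_add, hx, hy]
  | smul a x _ hx => simp only [Pi.smul_apply, map_smul, hx]

/-- If `ψ : N → B` is injective locally on `Proj A`, then it extends to an embedding into `B` of
the graded module of the sections of all twists of the sheaf of `N`, provided that two elements
`p` and `q` of positive degree become coprime in `B`. -/
theorem exists_sectionModule_embedding {𝒜 : ℕ → Set A} {𝒩 : ℤ → Set N} (ψ : N →ₗ[A] B)
    (h0 : ∀ d, (0 : N) ∈ 𝒩 d)
    (hψ : ∀ p : PosHomogeneous 𝒜, p.elt ≠ 0 → ∀ x, ψ x = 0 → ∃ c : ℕ, p.elt ^ c • x = 0)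
    (p q : PosHomogeneous 𝒜) (hp : p.elt ≠ 0) (hq : q.elt ≠ 0)
    (hpq : ∀ (a : B) (k m : ℕ), algebraMap A B p.elt ^ k ∣ algebraMap A B q.elt ^ m * a →
      algebraMap A B p.elt ^ k ∣ a) :
    ∃ Ψ : sectionModule 𝒜 𝒩 →ₗ[A] B, Function.Injective Ψ ∧
      (∀ (σ : sectionModule 𝒜 𝒩) (r : PosHomogeneous 𝒜), r.elt ≠ 0 → ∀ (x : N) (k : ℕ),
        σ.1 r = LocalizedModule.mk x (Submonoid.pow r.elt k) →
          algebraMap A B r.elt ^ k * Ψ σ = ψ x) ∧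
      ∀ (d : ℤ) (F : B), (∀ r : PosHomogeneous 𝒜, r.elt ≠ 0 →
          ∃ (k : ℕ) (x : N), x ∈ 𝒩 (d + k * r.deg) ∧ ψ x = algebraMap A B r.elt ^ k * F) →
        ∃ σ : sectionModule 𝒜 𝒩, σ.1 ∈ twistSections 𝒜 𝒩 d ∧ Ψ σ = F := by
  have hinj := IsFractionRing.injective B (FractionRing B)
  have hdom : IsDomain A := (FaithfulSMul.algebraMap_injective A B).isDomain
  have smul_eq : ∀ (g : A) (k : ℕ) (b : B), g ^ k • algebraMap B (FractionRing B) b =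
      algebraMap B (FractionRing B) (algebraMap A B g ^ k * b) := by
    intro g k b
    rw [Algebra.smul_def, map_pow, map_mul, map_pow,
      ← IsScalarTower.algebraMap_apply A B (FractionRing B)]
  have hex : ∀ σ : sectionModule 𝒜 𝒩, ∃ b : B,
      algebraMap B (FractionRing B) b = localValue ψ p.elt hp (σ.1 p) := by
    intro σ
    obtain ⟨x, k, hx⟩ := exists_eq_mk p.elt (σ.1 p)
    obtain ⟨y, m, hy⟩ := exists_eq_mk q.elt (σ.1 q)
    have h1 := pow_smul_localValue_mk ψ p.elt hp x k
    have h2 := pow_smul_localValue_mk ψ q.elt hq y m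
    rw [← hx] at h1
    rw [← hy, ← localValue_eq_of_mem_sectionModule ψ σ.2 p q hp hq] at h2
    -- The common value is both `ψ x / p ^ k` and `ψ y / q ^ m`. Cross-multiplying, coprimality
    -- forces `p ^ k` to divide `ψ x`.
    have h3 : algebraMap A B p.elt ^ k * ψ y = algebraMap A B q.elt ^ m * ψ x := by
      apply hinj
      rw [← smul_eq, ← smul_eq, ← h1, ← h2, smul_comm]
    obtain ⟨b, hb⟩ := hpq _ _ _ (Dvd.intro _ h3)
    refine ⟨b, eq_of_pow_smul_eq hp (k := k) ?_⟩
    rw [h1, smul_eq, hb]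
  choose val hval using hex
  let Ψ : sectionModule 𝒜 𝒩 →ₗ[A] B :=
    { toFun := val
      map_add' := fun x y => hinj (by
        rw [map_add, hval, hval, hval]; simp)
      map_smul' := fun a x => hinj (by
        rw [hval, RingHom.id_apply, Algebra.smul_def, map_mul, hval,
          ← IsScalarTower.algebraMap_apply A B (FractionRing B), ← Algebra.smul_def]
        simp) }
  have hΨ : ∀ (σ : sectionModule 𝒜 𝒩) (r : PosHomogeneous 𝒜) (hr : r.elt ≠ 0),
      algebraMap B (FractionRing B) (Ψ σ) = localValue ψ r.elt hr (σ.1 r) := fun σ r hr =>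
    (hval σ).trans (localValue_eq_of_mem_sectionModule ψ σ.2 p r hp hr)
  have hΨinj : Function.Injective Ψ := by
    rw [injective_iff_map_eq_zero]
    intro σ hσ
    ext r
    by_cases hr : r.elt = 0
    -- The zero element may occur as an index of positive degree; localizing at it gives the zero
    -- module.
    · have : Subsingleton (LocalizedModule (Submonoid.powers r.elt) N) :=
        LocalizedModule.subsingleton ⟨1, by simp [hr]⟩
      exact Subsingleton.elim _ _
    · refine localValue_injective ψ r.elt hr (hψ r hr) ?_
      rw [← hΨ σ r hr, hσ, map_zero]
      simp
  refine ⟨Ψ, hΨinj, fun σ r hr x k hx => hinj ?_, fun d F hF => ?_⟩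
  · rw [← smul_eq, hΨ σ r hr, hx, pow_smul_localValue_mk]
  · choose! k x hx hxF using hF
    classical
    let σ : ∀ r : PosHomogeneous 𝒜, LocalizedModule (Submonoid.powers r.elt) N := fun r =>
      if r.elt = 0 then 0 else LocalizedModule.mk (x r) (Submonoid.pow r.elt (k r))
    have hval' : ∀ (r : PosHomogeneous 𝒜) (hr : r.elt ≠ 0),
        localValue ψ r.elt hr (σ r) = algebraMap B (FractionRing B) F := by
      intro r hr
      refine eq_of_pow_smul_eq hr (k := k r) ?_
      simp only [σ, if_neg hr]
      rw [pow_smul_localValue_mk, hxF r hr, smul_eq]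
    have hσ : σ ∈ twistSections 𝒜 𝒩 d := by
      refine ⟨fun r => ?_, fun r s => ?_⟩
      · by_cases hr : r.elt = 0
        · exact ⟨0, 0, h0 _, by simp [σ, hr]⟩
        · exact ⟨k r, x r, hx r hr, by simp [σ, hr]⟩
      · by_cases hrs : r.elt * s.elt = 0
        · have : Subsingleton (LocalizedModule (Submonoid.powers (r.elt * s.elt)) N) :=
            LocalizedModule.subsingleton ⟨1, by simp [hrs]⟩
          exact Subsingleton.elim _ _
        · have hr := left_ne_zero_of_mul hrs
          have hs := right_ne_zero_of_mul hrs
          -- Both restrictions to the overlap have the value `F`, and values there determine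
          -- sections, since torsion for `r` is torsion for `r * s`.
          refine localValue_injective ψ _ hrs (fun y hy => ?_) ?_
          · obtain ⟨c, hc⟩ := hψ r hr y hy
            exact ⟨c, by rw [mul_pow, mul_comm, mul_smul, hc, smul_zero]⟩
          · rw [localValue_restrict ψ r.elt _ _ hr hrs, localValue_restrict ψ s.elt _ _ hs hrs,
              hval' r hr, hval' s hs]
    refine ⟨⟨σ, Submodule.subset_span (Set.mem_iUnion.mpr ⟨d, hσ⟩)⟩, hσ, hinj ?_⟩
    rw [hΨ _ p hp, hval' p hp]

end SectionValues

/-! ### Homogeneous components and integer degrees -/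

section Homogeneous

variable {K : Type*} [Field K] {n : ℕ}

attribute [local instance] MvPolynomial.gradedAlgebra in
theorem homogeneousComponent_add_mul {a : Poly K n} {k : ℕ} (ha : a.IsHomogeneous k) (j : ℕ)
    (F : Poly K n) : MvPolynomial.homogeneousComponent (k + j) (a * F) =
      a * MvPolynomial.homogeneousComponent j F := by
  rw [← MvPolynomial.decomposition.decompose'_apply, ← MvPolynomial.decomposition.decompose'_apply]
  exact DirectSum.coe_decompose_mul_add_of_left_mem
    (MvPolynomial.homogeneousSubmodule (Fin (n + 2)) K) (a := a) (b := F) (j := j) ha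

attribute [local instance] MvPolynomial.gradedAlgebra in
theorem homogeneousComponent_mul_of_lt {a : Poly K n} {k : ℕ} (ha : a.IsHomogeneous k) {j : ℕ}
    (hj : j < k) (F : Poly K n) : MvPolynomial.homogeneousComponent j (a * F) = 0 := by
  rw [← MvPolynomial.decomposition.decompose'_apply]
  exact DirectSum.coe_decompose_mul_of_left_mem_of_not_le
    (MvPolynomial.homogeneousSubmodule (Fin (n + 2)) K) (a := a) (b := F) (n := j) ha
    (not_le.mpr hj)

theorem mem_homogeneousPart_natCast {d : ℕ} {F : Poly K n} :
    F ∈ homogeneousPart (d : ℤ) ↔ F.IsHomogeneous d := Iff.rfl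

theorem mem_homogeneousPart_of_neg {d : ℤ} (hd : d < 0) {F : Poly K n} :
    F ∈ homogeneousPart d ↔ F = 0 := by
  obtain ⟨k, rfl⟩ := Int.eq_negSucc_of_lt_zero hd
  exact Submodule.mem_bot K

theorem isHomogeneous_of_homogeneousComponent {d : ℕ} {F : Poly K n}
    (h : ∀ j, j ≠ d → MvPolynomial.homogeneousComponent j F = 0) : F.IsHomogeneous d := by
  rw [← MvPolynomial.sum_homogeneousComponent F]
  refine MvPolynomial.IsHomogeneous.sum _ _ _ fun j _ => ?_
  by_cases hj : j = d
  · exact hj ▸ MvPolynomial.homogeneousComponent_isHomogeneous j F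
  · rw [h j hj]; exact MvPolynomial.isHomogeneous_zero _ _ _

/-- This form of the condition treats negative degrees like all others, so that multiplication and
cancellation of forms need no separate case for them. -/
theorem mem_homogeneousPart_iff {d : ℤ} {F : Poly K n} :
    F ∈ homogeneousPart d ↔ ∀ j : ℕ, (j : ℤ) ≠ d → MvPolynomial.homogeneousComponent j F = 0 := by
  rcases lt_or_ge d 0 with hd | hd
  · rw [mem_homogeneousPart_of_neg hd]
    refine ⟨fun h j _ => by rw [h, map_zero], fun h => ?_⟩
    rw [← MvPolynomial.sum_homogeneousComponent F]
    exact Finset.sum_eq_zero fun j _ => h j (by omega)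
  · lift d to ℕ using hd
    rw [mem_homogeneousPart_natCast]
    refine ⟨fun h j hj => ?_, fun h =>
      isHomogeneous_of_homogeneousComponent fun j hj => h j (by exact_mod_cast hj)⟩
    rw [MvPolynomial.homogeneousComponent_of_mem h, if_neg (by exact_mod_cast hj)]

theorem mul_mem_homogeneousPart_iff {a : Poly K n} {k : ℕ} (ha : a.IsHomogeneous k) (ha0 : a ≠ 0)
    {d : ℤ} {F : Poly K n} : a * F ∈ homogeneousPart (k + d) ↔ F ∈ homogeneousPart d := by
  rw [mem_homogeneousPart_iff, mem_homogeneousPart_iff]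
  refine ⟨fun h j hj => ?_, fun h j hj => ?_⟩
  · have := h (k + j) (by push_cast; omega)
    rw [homogeneousComponent_add_mul ha] at this
    exact (mul_eq_zero.mp this).resolve_left ha0
  · rcases lt_or_ge j k with hjk | hjk
    · exact homogeneousComponent_mul_of_lt ha hjk F
    · obtain ⟨i, rfl⟩ := Nat.exists_eq_add_of_le hjk
      rw [homogeneousComponent_add_mul ha, h i (by push_cast at hj; omega), mul_zero]

theorem mul_mem_homogeneousPart {a : Poly K n} {k : ℕ} (ha : a.IsHomogeneous k)
    {d : ℤ} {F : Poly K n} (hF : F ∈ homogeneousPart d) : a * F ∈ homogeneousPart (k + d) := by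
  by_cases ha0 : a = 0
  · rw [ha0, zero_mul]; exact zero_mem _
  · exact (mul_mem_homogeneousPart_iff ha ha0).mpr hF

theorem homogeneousComponent_of_mem_homogeneousPart {j : ℕ} {F : Poly K n}
    (hF : F ∈ homogeneousPart (j : ℤ)) : MvPolynomial.homogeneousComponent j F = F := by
  rw [MvPolynomial.homogeneousComponent_of_mem hF, if_pos rfl]

end Homogeneous

/-! ### Powers of the ideal of a linear subspace -/

section Powers

variable {K : Type*} [Field K] {n : ℕ} [Infinite K]

/-- If the product of `F` with the `k`-th power of a linear form that vanishes on `Q` lies in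
`I(Q) ^ (d + k)`, then `F` lies in `I(Q) ^ d`. -/
theorem mem_idealOf_pow_of_pow_mul_mem (Q : Submodule K (Vec K n)) {c : Vec K n} (hc : c ∈ perp Q)
    (hc0 : c ≠ 0) {F : Poly K n} {d k : ℕ} (h : linForm c ^ k * F ∈ idealOf Q ^ (d + k)) :
    F ∈ idealOf Q ^ d := by
  obtain ⟨π, h1, h2⟩ := exists_projection Q
  -- With `T` for the new variable, `ρ` scales the directions transversal to `Q` by `T`. The order
  -- in `T` then detects the power of `I(Q)`: elements of `I(Q)^j` become divisible by `T^j`, the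
  -- coefficient of `T^j` always lies in `I(Q)^j` (`hrees`), and `T = 1` recovers the polynomial.
  let ρ : Poly K n →ₐ[K] Polynomial (Poly K n) := MvPolynomial.aeval fun i =>
    Polynomial.C (subst π (MvPolynomial.X i)) +
      Polynomial.X * Polynomial.C (MvPolynomial.X i - subst π (MvPolynomial.X i))
  have hρlin : ∀ a ∈ perp Q, ρ (linForm a) = Polynomial.X * Polynomial.C (linForm a) := by
    intro a ha
    have e1 : ρ (linForm a) = Polynomial.C (subst π (linForm a)) +
        Polynomial.X * Polynomial.C (linForm a - subst π (linForm a)) := by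
      simp only [linForm, ← MvPolynomial.smul_eq_C_mul, map_sum, map_smul, ρ,
        MvPolynomial.aeval_X]
      simp only [← Finset.sum_sub_distrib, ← smul_sub, map_sum, Finset.mul_sum,
        ← Finset.sum_add_distrib]
      refine Finset.sum_congr rfl fun i _ => ?_
      simp only [map_mul, Algebra.smul_def]
      rw [IsScalarTower.algebraMap_apply K (Poly K n) (Polynomial (Poly K n))]
      simp only [Polynomial.algebraMap_apply, MvPolynomial.algebraMap_eq, Algebra.algebraMap_self,
        RingHom.id_apply]
      ring
    have e2 : subst π (linForm a) = 0 := by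
      refine MvPolynomial.funext fun v => ?_
      rw [eval_subst, eval_linForm, ha _ (h1 v), map_zero]
    rw [e1, e2]
    simp
  have hρ : ∀ (j : ℕ) (G : Poly K n), G ∈ idealOf Q ^ j → Polynomial.X ^ j ∣ ρ G := by
    intro j G hG
    have h3 : (idealOf Q).map ρ ≤ Ideal.span {Polynomial.X} := by
      rw [idealOf_eq_span, Ideal.map_span, Ideal.span_le]
      rintro _ ⟨_, ⟨a, ha, rfl⟩, rfl⟩
      exact Ideal.mem_span_singleton.mpr (Dvd.intro _ (hρlin a ha).symm)
    have h4 := Ideal.pow_right_mono h3 j (Ideal.map_pow ρ (idealOf Q) j ▸ Ideal.mem_map_of_mem ρ hG)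
    rwa [Ideal.span_singleton_pow, Ideal.mem_span_singleton] at h4
  have hrees : ∀ G, ρ G ∈ reesAlgebra (idealOf Q) := by
    intro G
    induction G using MvPolynomial.induction_on with
    | C a =>
      rw [← MvPolynomial.algebraMap_eq, AlgHom.commutes,
        IsScalarTower.algebraMap_apply K (Poly K n) (Polynomial (Poly K n))]
      exact Subalgebra.algebraMap_mem _ _
    | add p q hp hq => rw [map_add]; exact add_mem hp hq
    | mul_X p i hp =>
      rw [map_mul]
      refine mul_mem hp ?_
      rw [MvPolynomial.aeval_X]
      refine add_mem (Subalgebra.algebraMap_mem (reesAlgebra (idealOf Q)) _) ?_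
      rw [mul_comm, Polynomial.C_mul_X_eq_monomial, reesAlgebra.monomial_mem, pow_one]
      intro x hx
      change MvPolynomial.eval _ _ = _
      rw [map_sub, eval_subst, h2 x hx, sub_self]
  have heval : ∀ G, (ρ G).eval 1 = G := by
    intro G
    have : ((Polynomial.aeval (1 : Poly K n)).restrictScalars K).comp ρ = AlgHom.id K _ := by
      refine MvPolynomial.algHom_ext fun i => ?_
      simp [ρ]
    simpa using AlgHom.congr_fun this G
  -- The image of the linear form is `T` times a nonzero constant in `T`: the factor `T^k` cancels,
  -- and the constant is prime to `T`.
  have hdvd : Polynomial.X ^ d ∣ ρ F := by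
    have h5 := hρ _ _ h
    rw [map_mul, map_pow, hρlin c hc, mul_pow, add_comm d k, pow_add, mul_assoc,
      mul_dvd_mul_iff_left (pow_ne_zero _ Polynomial.X_ne_zero), ← map_pow] at h5
    refine Polynomial.prime_X.pow_dvd_of_dvd_mul_left d ?_ h5
    rw [Polynomial.X_dvd_iff, Polynomial.coeff_C_zero]
    exact pow_ne_zero _ (linForm_ne_zero hc0)
  rw [← heval F, Polynomial.eval_eq_sum_range]
  refine sum_mem fun j _ => ?_
  rw [one_pow, mul_one]
  rcases lt_or_ge j d with hj | hj
  · rw [Polynomial.X_pow_dvd_iff.mp hdvd j hj]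
    exact zero_mem _
  · exact Ideal.pow_le_pow_right hj (hrees F j)

end Powers

/-! ### The form attached to a tuple of polynomials on the line -/

section DualForm

variable {K : Type*} [Field K] {n : ℕ}

theorem exists_dotProduct_eq (L : Submodule K (Vec K n)) (φ : L →ₗ[K] K) :
    ∃ a : Vec K n, ∀ x : L, φ x = (x : Vec K n) ⬝ᵥ a := by
  obtain ⟨g, hg⟩ := φ.exists_extend
  refine ⟨fun i => g (Pi.single i 1), fun x => ?_⟩
  rw [← hg, LinearMap.comp_apply, Submodule.subtype_apply]
  conv_lhs => rw [pi_eq_sum_univ' (x : Vec K n), map_sum]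
  simp [dotProduct]

/-- Coordinates on a two-dimensional subspace `L`: a basis `u, v` of `L`, and linear forms with
coefficients `a, b` that restrict to the dual basis. -/
structure LineCoords (L : Submodule K (Vec K n)) (u v a b : Vec K n) : Prop where
  left_mem : u ∈ L
  right_mem : v ∈ L
  left_left : u ⬝ᵥ a = 1
  left_right : u ⬝ᵥ b = 0
  right_left : v ⬝ᵥ a = 0
  right_right : v ⬝ᵥ b = 1
  eq_add : ∀ w ∈ L, w = (w ⬝ᵥ a) • u + (w ⬝ᵥ b) • v

theorem exists_lineCoords {L : Submodule K (Vec K n)} (hL : Module.finrank K L = 2) :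
    ∃ u v a b, LineCoords L u v a b := by
  let B := Module.finBasisOfFinrankEq K L hL
  obtain ⟨a, ha⟩ := exists_dotProduct_eq L (B.coord 0)
  obtain ⟨b, hb⟩ := exists_dotProduct_eq L (B.coord 1)
  refine ⟨B 0, B 1, a, b, (B 0).2, (B 1).2, ?_, ?_, ?_, ?_, fun w hw => ?_⟩
  · rw [← ha]; simp
  · rw [← hb]; simp
  · rw [← ha]; simp
  · rw [← hb]; simp
  · have h := B.sum_repr ⟨w, hw⟩
    rw [Fin.sum_univ_two] at h
    have ha' := ha ⟨w, hw⟩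
    have hb' := hb ⟨w, hw⟩
    simp only [Module.Basis.coord_apply] at ha' hb'
    rw [← ha', ← hb']
    exact (congrArg Subtype.val h).symm

theorem LineCoords.left_notMem {L : Submodule K (Vec K n)} {u v a b : Vec K n}
    (hc : LineCoords L u v a b) : a ∉ perp L := fun h => by
  have := h u hc.left_mem
  rw [dotProduct_comm, hc.left_left] at this
  exact one_ne_zero this

theorem LineCoords.right_notMem {L : Submodule K (Vec K n)} {u v a b : Vec K n}
    (hc : LineCoords L u v a b) : b ∉ perp L := fun h => by
  have := h v hc.right_mem
  rw [dotProduct_comm, hc.right_right] at this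
  exact one_ne_zero this

/-- The map `(f_i) ↦ ∑ τ(f_i) X_i`, on representatives `f_i` of elements of `S/I(L)`. -/
def dualForm (M : Vec K n →ₗ[K] Vec K n) : (Fin (n + 2) → Poly K n) →ₗ[K] Poly K n where
  toFun f := ∑ i, subst M (f i) * MvPolynomial.X i
  map_add' f g := by simp [add_mul, Finset.sum_add_distrib]
  map_smul' c f := by simp [Finset.smul_sum]

theorem dualForm_apply (M : Vec K n →ₗ[K] Vec K n) (f : Fin (n + 2) → Poly K n) :
    dualForm M f = ∑ i, subst M (f i) * MvPolynomial.X i := rfl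

theorem eval_dualForm (M : Vec K n →ₗ[K] Vec K n) (f : Fin (n + 2) → Poly K n) (v : Vec K n) :
    MvPolynomial.eval v (dualForm M f) = (fun i => MvPolynomial.eval (M v) (f i)) ⬝ᵥ v := by
  simp [dualForm_apply, dotProduct]

theorem dualForm_smul (M : Vec K n →ₗ[K] Vec K n) (s : Poly K n) (f : Fin (n + 2) → Poly K n) :
    dualForm M (s • f) = subst M s * dualForm M f := by
  simp [dualForm_apply, Finset.mul_sum, mul_assoc]

theorem homogeneousComponent_dualForm (M : Vec K n →ₗ[K] Vec K n) (f : Fin (n + 2) → Poly K n)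
    (j : ℕ) : MvPolynomial.homogeneousComponent (j + 1) (dualForm M f) =
      dualForm M fun i => MvPolynomial.homogeneousComponent j (f i) := by
  have hsub : ∀ g : Poly K n, MvPolynomial.homogeneousComponent j (subst M g) =
      subst M (MvPolynomial.homogeneousComponent j g) := by
    intro g
    conv_lhs => rw [← MvPolynomial.sum_homogeneousComponent g, map_sum, map_sum]
    rw [Finset.sum_congr rfl fun i _ => MvPolynomial.homogeneousComponent_of_mem
      (isHomogeneous_subst M (MvPolynomial.homogeneousComponent_isHomogeneous i g))]
    rw [Finset.sum_ite_eq]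
    split_ifs with h
    · rfl
    · rw [MvPolynomial.homogeneousComponent_eq_zero _ _ (by simpa [Nat.lt_succ_iff] using h),
        map_zero]
  rw [dualForm_apply, dualForm_apply, map_sum]
  refine Finset.sum_congr rfl fun i _ => ?_
  rw [mul_comm, add_comm j 1, homogeneousComponent_add_mul (MvPolynomial.isHomogeneous_X K i),
    hsub, mul_comm]

namespace IsMinorMap

variable {L : Submodule K (Vec K n)} {M : Vec K n →ₗ[K] Vec K n}

theorem dualForm_X (hM : IsMinorMap L M) [Infinite K] : dualForm M MvPolynomial.X = 0 := by
  refine MvPolynomial.funext fun v => ?_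
  rw [eval_dualForm, map_zero]
  simpa using hM.dot_self v

variable [Infinite K]

theorem dualForm_eq_zero_of_mem (hM : IsMinorMap L M) {f : Fin (n + 2) → Poly K n}
    (hf : ∀ i, f i ∈ idealOf L) : dualForm M f = 0 := by
  rw [dualForm_apply]
  exact Finset.sum_eq_zero fun i _ => by rw [(subst_eq_zero_iff hM.range_eq).mpr (hf i), zero_mul]

/-- The kernel of `dualForm` consists of the multiples of the Euler derivation on `L`. -/
theorem exists_of_dualForm_eq_zero (hM : IsMinorMap L M) (hL : Module.finrank K L = 2)
    {f : Fin (n + 2) → Poly K n} (hf : dualForm M f = 0) :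
    ∃ g : Poly K n, ∀ i, f i - g * MvPolynomial.X i ∈ idealOf L := by
  obtain ⟨u, v, a, b, hc⟩ := exists_lineCoords hL
  let F : Vec K n → Vec K n := fun w i => MvPolynomial.eval w (f i)
  have hF : ∀ x, F (M x) ⬝ᵥ x = 0 := fun x => by rw [← eval_dualForm, hf, map_zero]
  -- Adding `q ∈ Q` to `x` does not change `M x`, so the relation at `x + q` gives `F w ⬝ᵥ q = 0`;
  -- hence `F w` lies in `Q^⊥ = L`.
  have hFL : ∀ w ∈ L, F w ∈ L := by
    intro w hw
    rw [← perp_perp L]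
    intro q hq
    obtain ⟨x, rfl⟩ := hM.exists_eq hw
    have h1 := hF (x + q)
    rwa [map_add, hM.eq_zero_iff.mpr hq, add_zero, dotProduct_add, hF, zero_add] at h1
  let fa : Poly K n := ∑ i, MvPolynomial.C (a i) * f i
  let fb : Poly K n := ∑ i, MvPolynomial.C (b i) * f i
  have hfa : ∀ w, MvPolynomial.eval w fa = F w ⬝ᵥ a := fun w => by
    simp [fa, F, dotProduct, mul_comm]
  have hfb : ∀ w, MvPolynomial.eval w fb = F w ⬝ᵥ b := fun w => by
    simp [fb, F, dotProduct, mul_comm]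
  -- For `w = M x`, both `w` and `F w` lie in the plane `L` and are orthogonal to `x`. If `x ∉ L^⊥`,
  -- they lie on one line, so their determinant in the coordinates `a, b` vanishes; otherwise `w =
  -- 0`.
  have hdet : ∀ w ∈ L, (F w ⬝ᵥ a) * (w ⬝ᵥ b) = (F w ⬝ᵥ b) * (w ⬝ᵥ a) := by
    intro w hw
    obtain ⟨x, rfl⟩ := hM.exists_eq hw
    by_cases hx : x ∈ perp L
    · rw [hM.eq_zero_iff.mpr hx]; simp
    have e1 := hF x
    have e2 := hM.dot_self x
    rw [hc.eq_add _ (hFL _ hw), add_dotProduct, smul_dotProduct, smul_dotProduct] at e1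
    rw [hc.eq_add _ hw, add_dotProduct, smul_dotProduct, smul_dotProduct] at e2
    simp only [smul_eq_mul] at e1 e2
    by_cases hux : u ⬝ᵥ x = 0
    · by_cases hvx : v ⬝ᵥ x = 0
      · refine absurd (fun y hy => ?_) hx
        rw [dotProduct_comm, hc.eq_add y hy, add_dotProduct, smul_dotProduct, smul_dotProduct,
          hux, hvx]
        simp
      · refine mul_right_cancel₀ hvx ?_
        linear_combination (F (M x) ⬝ᵥ a) * e2 - (M x ⬝ᵥ a) * e1
    · refine mul_right_cancel₀ hux ?_
      linear_combination (M x ⬝ᵥ b) * e1 - (F (M x) ⬝ᵥ b) * e2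
  -- On the line where `a` vanishes, `fa * b` vanishes and `b` does not vanish identically;
  -- primality cancels `b`. Thus `a` divides `fa` modulo `I(L)`, and the quotient is the required
  -- multiplier `g`.
  have hline : fa ∈ idealOf (Submodule.span K {v}) := by
    refine ((isPrime_idealOf (Submodule.span K {v})).mem_or_mem (x := fa) (y := linForm b)
      ?_).resolve_right ?_
    · intro x hx
      obtain ⟨c, rfl⟩ := Submodule.mem_span_singleton.mp hx
      have := hdet (c • v) (L.smul_mem c hc.right_mem)
      rw [smul_dotProduct c v a, hc.right_left, smul_zero, mul_zero] at this
      change MvPolynomial.eval _ _ = _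
      rw [map_mul, hfa, eval_linForm, dotProduct_comm b, this]
    · rw [linForm_mem_idealOf]
      intro h
      have := h v (Submodule.mem_span_singleton_self v)
      rw [dotProduct_comm, hc.right_right] at this
      exact one_ne_zero this
  obtain ⟨e, he, hfe⟩ := exists_sub_mem_idealOf (h := fa) hc.left_mem hc.left_left (by
    intro x hx hxa
    refine hline x ?_
    rw [hc.eq_add x hx, hxa, zero_smul, zero_add]
    exact Submodule.smul_mem _ _ (Submodule.mem_span_singleton_self v))
  rw [idealOf_perp_singleton, Ideal.mem_span_singleton] at hfe
  obtain ⟨g, hg⟩ := hfe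
  have hga : ∀ w ∈ L, F w ⬝ᵥ a = MvPolynomial.eval w g * (w ⬝ᵥ a) := by
    intro w hw
    have h1 := congrArg (MvPolynomial.eval w) hg
    have h2 : MvPolynomial.eval w e = 0 := he w hw
    rw [map_sub, h2, sub_zero, hfa, map_mul, eval_linForm, dotProduct_comm a] at h1
    rw [h1, mul_comm]
  have hgb : fb - g * linForm b ∈ idealOf L := by
    refine ((isPrime_idealOf L).mem_or_mem (x := linForm a) ?_).resolve_left ?_
    · intro w hw
      change MvPolynomial.eval _ _ = _
      rw [map_mul, map_sub, map_mul, hfb, eval_linForm, eval_linForm, dotProduct_comm a,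
        dotProduct_comm b]
      linear_combination (w ⬝ᵥ b) * hga w hw - hdet w hw
    · rw [linForm_mem_idealOf]
      intro h
      have := h u hc.left_mem
      rw [dotProduct_comm, hc.left_left] at this
      exact one_ne_zero this
  refine ⟨g, fun i w hw => ?_⟩
  have h1 : F w ⬝ᵥ b = MvPolynomial.eval w g * (w ⬝ᵥ b) := by
    have : MvPolynomial.eval w (fb - g * linForm b) = 0 := hgb w hw
    rw [map_sub, map_mul, hfb, eval_linForm, dotProduct_comm b] at this
    exact sub_eq_zero.mp this
  have h2 := congrFun (hc.eq_add _ (hFL w hw)) i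
  have h3 := congrFun (hc.eq_add _ hw) i
  rw [hga w hw, h1] at h2
  simp only [Pi.add_apply, Pi.smul_apply, smul_eq_mul] at h2 h3
  change MvPolynomial.eval _ _ = _
  rw [map_sub, map_mul, MvPolynomial.eval_X]
  change F w i - _ = 0
  rw [h2]
  linear_combination -(MvPolynomial.eval w g) * h3

theorem subst_mem_pow (hM : IsMinorMap L M) {f : Poly K n} {d : ℕ} (hf : f.IsHomogeneous d) :
    subst M f ∈ idealOf (perp L) ^ d := by
  rw [hM.idealOf_perp_eq, Ideal.mem_span_pow_iff_exists_isHomogeneous]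
  refine ⟨MvPolynomial.map MvPolynomial.C f, hf.map _, ?_⟩
  rw [MvPolynomial.eval_map]
  exact (AlgHom.congr_fun (MvPolynomial.aeval_unique (subst M)) f).symm

/-- The forms of degree `d + 1` in `I(Q) ^ d` are the images under `dualForm` of the tuples of
forms of degree `d`. -/
theorem exists_dualForm_eq (hM : IsMinorMap L M) {F : Poly K n} {d : ℕ}
    (hF : F ∈ idealOf (perp L) ^ d) (hFd : F.IsHomogeneous (d + 1)) :
    ∃ f : Fin (n + 2) → Poly K n, (∀ i, (f i).IsHomogeneous d) ∧ dualForm M f = F := by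
  rw [hM.idealOf_perp_eq, Ideal.mem_span_pow_iff_exists_isHomogeneous] at hF
  obtain ⟨p, hp, rfl⟩ := hF
  let T : Submodule K (Poly K n) :=
    (Submodule.pi Set.univ fun _ => MvPolynomial.homogeneousSubmodule (Fin (n + 2)) K d).map
      (dualForm M)
  -- Here `F` is a homogeneous polynomial of degree `d` in the `M_i` with coefficients in `R`.
  -- Monomials of degree `d` in the `M_i` are forms of degree `d`, so only the linear parts of the
  -- coefficients contribute to degree `d + 1`; the coefficients of these linear parts give the
  -- tuple.
  suffices h : MvPolynomial.homogeneousComponent (d + 1)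
      (MvPolynomial.eval (fun i => subst M (MvPolynomial.X i)) p) ∈ T by
    rw [MvPolynomial.homogeneousComponent_of_mem hFd, if_pos rfl] at h
    obtain ⟨f, hf, hfF⟩ := h
    exact ⟨f, fun i => hf i (Set.mem_univ i), hfF⟩
  rw [MvPolynomial.eval_eq, map_sum]
  refine sum_mem fun μ hμ => ?_
  have hμd : (MvPolynomial.monomial μ (1 : K)).IsHomogeneous d :=
    MvPolynomial.isHomogeneous_monomial _ 
      (hp.degree_eq_sum_deg_support hμ).symm
  have hmon : ∏ i ∈ μ.support, subst M (MvPolynomial.X i) ^ μ i =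
      subst M (MvPolynomial.monomial μ 1) := by
    rw [MvPolynomial.monomial_eq, map_mul, Finsupp.prod, map_prod]
    simp
  rw [hmon, mul_comm, homogeneousComponent_add_mul (isHomogeneous_subst M hμd)]
  obtain ⟨c, hc⟩ := exists_eq_linForm
    (MvPolynomial.homogeneousComponent_isHomogeneous 1 (p.coeff μ))
  rw [hc]
  refine ⟨fun i => MvPolynomial.C (c i) * MvPolynomial.monomial μ 1,
    fun i _ => hμd.C_mul (c i), ?_⟩
  rw [dualForm_apply, linForm, Finset.mul_sum]
  refine Finset.sum_congr rfl fun i _ => ?_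
  rw [map_mul, ← MvPolynomial.algebraMap_eq, AlgHom.commutes]
  ring

end IsMinorMap

end DualForm

/-! ### Logarithmic derivations of the dual arrangement -/

section LogDerivations

variable {K : Type*} [Field K] {n : ℕ}

theorem derivation_linForm (θ : Derivation K (Poly K n) (Poly K n)) (a : Vec K n) :
    θ (linForm a) = ∑ i, MvPolynomial.C (a i) * θ (MvPolynomial.X i) := by
  simp [linForm, ← MvPolynomial.smul_eq_C_mul]

theorem sum_derivation_apply {ι : Type*} (s : Finset ι)
    (D : ι → Derivation K (Poly K n) (Poly K n)) (f : Poly K n) :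
    (∑ i ∈ s, D i) f = ∑ i ∈ s, D i f :=
  (congrFun (map_sum (Derivation.coeFnAddMonoidHom (R := K) (A := Poly K n) (M := Poly K n)) D s)
    f).trans (Finset.sum_apply f s _)

theorem euler_X (i : Fin (n + 2)) : euler K n (MvPolynomial.X i) = MvPolynomial.X i := by
  simp [euler, MvPolynomial.mkDerivation_X]

theorem euler_linForm (a : Vec K n) : euler K n (linForm a) = linForm a := by
  rw [derivation_linForm]
  simp [euler_X, linForm]

/-- The derivation along a constant vector field. -/
def constDer (c : Vec K n) : Derivation K (Poly K n) (Poly K n) :=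
  MvPolynomial.mkDerivation K fun i => MvPolynomial.C (c i)

theorem constDer_X (c : Vec K n) (i : Fin (n + 2)) :
    constDer c (MvPolynomial.X i) = MvPolynomial.C (c i) := MvPolynomial.mkDerivation_X _ _ _

theorem constDer_linForm (c a : Vec K n) : constDer c (linForm a) = MvPolynomial.C (c ⬝ᵥ a) := by
  rw [derivation_linForm]
  simp [constDer_X, dotProduct, mul_comm]

theorem eq_sum_constDer (θ : Derivation K (Poly K n) (Poly K n)) :
    θ = ∑ i, θ (MvPolynomial.X i) • constDer (Pi.single i 1) := by
  refine MvPolynomial.derivation_ext fun j => ?_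
  rw [sum_derivation_apply, Finset.sum_eq_single j]
  · simp [constDer_X]
  · intro i _ hij
    simp [constDer_X, hij.symm]
  · simp

/-- Meant for `c ⬝ᵥ a = 1`: the fields `e_i - a_i c` are then tangent to the hyperplane of `a`, and
the coefficient of the transversal field `c` is the value of `θ` on its equation. -/
theorem eq_sum_constDer_add (θ : Derivation K (Poly K n) (Poly K n)) (a c : Vec K n) :
    θ = ∑ i, θ (MvPolynomial.X i) • constDer (Pi.single i 1 - a i • c) +
      θ (linForm a) • constDer c := by
  refine MvPolynomial.derivation_ext fun j => ?_
  rw [derivation_linForm]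
  have h : ∀ i, θ (MvPolynomial.X i) • constDer (Pi.single i 1 - a i • c) =
      θ (MvPolynomial.X i) • constDer (Pi.single i 1) -
        (MvPolynomial.C (a i) * θ (MvPolynomial.X i)) • constDer c := by
    intro i
    refine MvPolynomial.derivation_ext fun j => ?_
    simp [constDer_X]
    ring
  rw [Finset.sum_congr rfl fun i _ => h i, Finset.sum_sub_distrib, ← eq_sum_constDer,
    ← Finset.sum_smul, sub_add_cancel]

/-- The derivation whose components are those of degree `j` of the components of `θ`. -/
def derComponent (j : ℕ) (θ : Derivation K (Poly K n) (Poly K n)) :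
    Derivation K (Poly K n) (Poly K n) :=
  MvPolynomial.mkDerivation K fun i =>
    MvPolynomial.homogeneousComponent j (θ (MvPolynomial.X i))

theorem derComponent_X (j : ℕ) (θ : Derivation K (Poly K n) (Poly K n)) (i : Fin (n + 2)) :
    derComponent j θ (MvPolynomial.X i) =
      MvPolynomial.homogeneousComponent j (θ (MvPolynomial.X i)) :=
  MvPolynomial.mkDerivation_X _ _ _

variable [Infinite K] {Z : Set (ℙ K (Vec K n))}

/-- The ideal of each hyperplane is principal, and by the Leibniz rule its generator suffices. -/
theorem mem_arrDer_iff {θ : Derivation K (Poly K n) (Poly K n)} :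
    θ ∈ arrDer (dualArrangement Z) ↔ ∀ P ∈ Z, linForm P.rep ∣ θ (linForm P.rep) := by
  constructor
  · intro h P hP
    have := h (idealOf (perp P.submodule)) ⟨_, ⟨P, hP, rfl⟩, rfl⟩ (linForm P.rep) (by
      rw [P.submodule_eq, idealOf_perp_singleton]
      exact Ideal.mem_span_singleton_self _)
    rwa [P.submodule_eq, idealOf_perp_singleton, Ideal.mem_span_singleton] at this
  · rintro h _ ⟨_, ⟨P, hP, rfl⟩, rfl⟩ f hf
    rw [P.submodule_eq, idealOf_perp_singleton, Ideal.mem_span_singleton] at hf ⊢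
    obtain ⟨g, rfl⟩ := hf
    rw [Derivation.leibniz]
    exact dvd_add (Dvd.intro _ rfl) ((h P hP).trans (Dvd.intro_left _ rfl))

theorem euler_mem_arrDer : euler K n ∈ arrDer (dualArrangement Z) :=
  mem_arrDer_iff.mpr fun P _ => by rw [euler_linForm]

/-- The logarithmic condition is divisibility by a form, which passes to homogeneous components. -/
theorem derComponent_mem (j : ℕ) {θ : Derivation K (Poly K n) (Poly K n)}
    (hθ : θ ∈ arrDer (dualArrangement Z)) : derComponent j θ ∈ arrDer (dualArrangement Z) := by
  rw [mem_arrDer_iff] at hθ ⊢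
  intro P hP
  have h : derComponent j θ (linForm P.rep) =
      MvPolynomial.homogeneousComponent j (θ (linForm P.rep)) := by
    rw [derivation_linForm, derivation_linForm, map_sum]
    simp [derComponent_X]
  rw [h]
  obtain ⟨g, hg⟩ := hθ P hP
  rw [hg]
  rcases j with _ | j
  · rw [homogeneousComponent_mul_of_lt (isHomogeneous_linForm _) one_pos]
    exact dvd_zero _
  · rw [add_comm j 1, homogeneousComponent_add_mul (isHomogeneous_linForm _)]
    exact Dvd.intro _ rfl

theorem prod_smul_mem (hZ : Z.Finite) (θ : Derivation K (Poly K n) (Poly K n)) :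
    (∏ P ∈ hZ.toFinset, linForm P.rep) • θ ∈ arrDer (dualArrangement Z) := by
  rw [mem_arrDer_iff]
  intro P hP
  exact Dvd.dvd.mul_right (Finset.dvd_prod_of_mem _ (hZ.mem_toFinset.mpr hP)) _

open scoped Classical in
theorem prod_erase_smul_mem (hZ : Z.Finite) {P : ℙ K (Vec K n)}
    {θ : Derivation K (Poly K n) (Poly K n)} (hθ : linForm P.rep ∣ θ (linForm P.rep)) :
    (∏ P' ∈ hZ.toFinset.erase P, linForm P'.rep) • θ ∈ arrDer (dualArrangement Z) := by
  rw [mem_arrDer_iff]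
  intro P' hP'
  by_cases h : P' = P
  · subst h
    exact Dvd.dvd.mul_left hθ _
  · refine Dvd.dvd.mul_right (Finset.dvd_prod_of_mem (fun P : ℙ K (Vec K n) => linForm P.rep) ?_) _
    exact Finset.mem_erase.mpr ⟨h, hZ.mem_toFinset.mpr hP'⟩

end LogDerivations

/-! ### Transversal lines and the passage from points to powers -/

section Transversal

variable {K : Type*} [Field K] {n : ℕ}

/-- The line `L` is contained in no hyperplane of the dual arrangement of `Z`, and it meets no
intersection of two of them. -/
structure IsTransversal (Z : Set (ℙ K (Vec K n))) (L : Submodule K (Vec K n)) : Prop where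
  exists_mem : ∀ P ∈ Z, ∃ u ∈ L, u ⬝ᵥ P.rep = 1
  eq_zero : ∀ P ∈ Z, ∀ P' ∈ Z, P ≠ P' → ∀ x ∈ L, x ⬝ᵥ P.rep = 0 → x ⬝ᵥ P'.rep = 0 → x = 0

/-- Every common zero of `J` lies in `L`, hence is the origin, where forms of positive degree
vanish; the Nullstellensatz applies. It converts existence of a suitable multiplier near each point
of `L` into existence of a power of `g` that works. -/
theorem exists_pow_mem [IsAlgClosed K] {L : Submodule K (Vec K n)} {J : Ideal (Poly K n)}
    (hLJ : idealOf L ≤ J) (hJ : ∀ x ∈ L, x ≠ 0 → ∃ s ∈ J, MvPolynomial.eval x s ≠ 0)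
    {g : Poly K n} {e : ℕ} (he : 0 < e) (hg : g.IsHomogeneous e) : ∃ c : ℕ, g ^ c ∈ J := by
  change g ∈ J.radical
  rw [← MvPolynomial.vanishingIdeal_zeroLocus_eq_radical (K := K) J]
  intro x hx
  change MvPolynomial.eval x g = 0
  have hxL : x ∈ L := by
    rw [← perp_perp L]
    intro c hc
    have := hx (linForm c) (hLJ (linForm_mem_idealOf.mpr hc))
    change MvPolynomial.eval x _ = 0 at this
    rwa [eval_linForm, dotProduct_comm] at this
  have hx0 : x = 0 := by
    by_contra h
    obtain ⟨s, hs, hsx⟩ := hJ x hxL h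
    exact hsx (hx s hs)
  rw [hx0]
  have h0 : MvPolynomial.coeff 0 g = 0 := hg.coeff_eq_zero (by simpa using he.ne)
  rw [← MvPolynomial.constantCoeff_eq] at h0
  rw [← h0]
  exact RingHom.congr_fun MvPolynomial.eval_zero g

open scoped Classical in
-- A nonzero vector of `L` lies on at most one of the hyperplanes. The two cases supply the local
-- multipliers used for the structure of `D(𝒜)` along `L`.
theorem IsTransversal.eval_prod_ne_zero {Z : Set (ℙ K (Vec K n))} {L : Submodule K (Vec K n)}
    (hT : IsTransversal Z L) (hZ : Z.Finite) {x : Vec K n} (hx : x ∈ L) (hx0 : x ≠ 0) :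
    MvPolynomial.eval x (∏ P ∈ hZ.toFinset, linForm P.rep) ≠ 0 ∨
      ∃ P ∈ Z, MvPolynomial.eval x (∏ P' ∈ hZ.toFinset.erase P, linForm P'.rep) ≠ 0 := by
  by_cases h : ∃ P ∈ Z, x ⬝ᵥ P.rep = 0
  · obtain ⟨P, hP, hPx⟩ := h
    refine Or.inr ⟨P, hP, ?_⟩
    rw [map_prod, Finset.prod_ne_zero_iff]
    intro P' hP'
    rw [Finset.mem_erase, Set.Finite.mem_toFinset] at hP'
    rw [eval_linForm, dotProduct_comm]
    exact fun h0 => hx0 (hT.eq_zero P hP P' hP'.2 hP'.1.symm x hx hPx h0)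
  · push Not at h
    left
    rw [map_prod, Finset.prod_ne_zero_iff]
    intro P hP
    rw [eval_linForm, dotProduct_comm]
    exact h P (hZ.mem_toFinset.mp hP)

/-- The functional `a` is onto on the plane `L`, so its kernel there is one-dimensional. -/
theorem exists_eq_smul {L : Submodule K (Vec K n)} (hL : Module.finrank K L = 2) {a u m y : Vec K n}
    (hu : u ∈ L) (hua : u ⬝ᵥ a = 1) (hm : m ∈ L) (hma : m ⬝ᵥ a = 0) (hm0 : m ≠ 0)
    (hy : y ∈ L) (hya : y ⬝ᵥ a = 0) : ∃ c : K, y = c • m := by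
  let φ : L →ₗ[K] K := (dotProductBilin K K a) ∘ₗ L.subtype
  have hφ : ∀ x : L, φ x = (x : Vec K n) ⬝ᵥ a := fun x => dotProduct_comm a x
  have hsurj : Function.Surjective φ := by
    intro c
    refine ⟨c • ⟨u, hu⟩, ?_⟩
    rw [map_smul, hφ, hua, smul_eq_mul, mul_one]
  have hker : Module.finrank K (LinearMap.ker φ) = 1 := by
    have := φ.finrank_range_add_finrank_ker
    rw [LinearMap.range_eq_top.mpr hsurj, finrank_top, hL, Module.finrank_self] at this
    omega
  have hmk : (⟨m, hm⟩ : L) ∈ LinearMap.ker φ := by rw [LinearMap.mem_ker, hφ, hma]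
  have hyk : (⟨y, hy⟩ : L) ∈ LinearMap.ker φ := by rw [LinearMap.mem_ker, hφ, hya]
  obtain ⟨c, hc⟩ := (finrank_eq_one_iff_of_nonzero' (⟨⟨m, hm⟩, hmk⟩ : LinearMap.ker φ) (by
    simpa [Subtype.ext_iff] using hm0)).mp hker ⟨⟨y, hy⟩, hyk⟩
  refine ⟨c, ?_⟩
  have := congrArg (fun z : LinearMap.ker φ => (z.1.1 : Vec K n)) hc
  exact this.symm

end Transversal

/-! ### The form of a class in the reduced module restricted to the line -/

section DerClass

variable {K : Type*} [Field K] {n : ℕ} {𝒜 : Set (Submodule K (Vec K n))}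
  {L : Submodule K (Vec K n)}

variable (𝒜 L) in
/-- The map `derClass` as a homomorphism of groups. -/
def derClassHom : arrDer 𝒜 →+ RedDerMod 𝒜 L where
  toFun := derClass 𝒜 L
  map_zero' := by rw [derClass, map_zero, map_zero]
  map_add' θ θ' := by rw [derClass, map_add, map_add]; rfl

theorem redDerMk_surjective :
    Function.Surjective (RedDer.mk (idealOf '' 𝒜) (euler K n)) :=
  Submodule.mkQ_surjective _

theorem derClassHom_surjective : Function.Surjective (derClassHom 𝒜 L) := by
  intro x
  obtain ⟨y, rfl⟩ : ∃ y, ModIdeal.mk (idealOf L) (ArrRedDer 𝒜) y = x :=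
    Submodule.mkQ_surjective _ x
  obtain ⟨θ, rfl⟩ := redDerMk_surjective y
  exact ⟨θ, rfl⟩

theorem derClassHom_smul (s : Poly K n) (θ : arrDer 𝒜) :
    derClassHom 𝒜 L (s • θ) = Ideal.Quotient.mk (idealOf L) s • derClassHom 𝒜 L θ := by
  change ModIdeal.mk _ _ (RedDer.mk _ _ (s • θ)) = _
  rw [map_smul]
  rfl

theorem redDerMk_eq_zero_iff {θ : arrDer 𝒜} :
    RedDer.mk (idealOf '' 𝒜) (euler K n) θ = 0 ↔ ∃ s : Poly K n, s • euler K n = θ.1 := by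
  have : RedDer.mk (idealOf '' 𝒜) (euler K n) θ = 0 ↔
      θ ∈ (Submodule.span (Poly K n) {euler K n}).submoduleOf (arrDer 𝒜) :=
    Submodule.Quotient.mk_eq_zero _
  rw [this, Submodule.submoduleOf, Submodule.mem_comap, Submodule.mem_span_singleton]
  rfl

theorem derClassHom_eq_zero_of_euler {θ : arrDer 𝒜} {s : Poly K n} (h : θ.1 = s • euler K n) :
    derClassHom 𝒜 L θ = 0 := by
  change ModIdeal.mk _ _ (RedDer.mk _ _ θ) = _
  rw [redDerMk_eq_zero_iff.mpr ⟨s, h.symm⟩, map_zero]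

theorem derClassHom_eq_zero_iff {θ : arrDer 𝒜} : derClassHom 𝒜 L θ = 0 ↔
    RedDer.mk (idealOf '' 𝒜) (euler K n) θ ∈
      idealOf L • (⊤ : Submodule (Poly K n) (ArrRedDer 𝒜)) :=
  Submodule.Quotient.mk_eq_zero _

/-- The form `∑ τ(θ(Y_i)) X_i` of a derivation `θ`. -/
def derForm (M : Vec K n →ₗ[K] Vec K n) : Derivation K (Poly K n) (Poly K n) →+ Poly K n where
  toFun θ := dualForm M fun i => θ (MvPolynomial.X i)
  map_zero' := (dualForm M).map_zero
  map_add' _ _ := (dualForm M).map_add _ _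

theorem derForm_apply (M : Vec K n →ₗ[K] Vec K n) (θ : Derivation K (Poly K n) (Poly K n)) :
    derForm M θ = dualForm M fun i => θ (MvPolynomial.X i) := rfl

theorem derForm_smul (M : Vec K n →ₗ[K] Vec K n) (s : Poly K n)
    (θ : Derivation K (Poly K n) (Poly K n)) : derForm M (s • θ) = subst M s * derForm M θ :=
  dualForm_smul M s _

theorem derForm_derComponent (M : Vec K n →ₗ[K] Vec K n) (j : ℕ)
    (θ : Derivation K (Poly K n) (Poly K n)) : derForm M (derComponent j θ) =
      MvPolynomial.homogeneousComponent (j + 1) (derForm M θ) := by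
  rw [derForm_apply, derForm_apply, homogeneousComponent_dualForm]
  simp only [derComponent_X]

namespace IsMinorMap

variable [Infinite K] {M : Vec K n →ₗ[K] Vec K n}

theorem derForm_euler (hM : IsMinorMap L M) : derForm M (euler K n) = 0 := by
  rw [derForm_apply]
  simp only [euler_X]
  exact hM.dualForm_X

theorem derForm_eq_of_redDerMk_eq (hM : IsMinorMap L M) {θ θ' : arrDer 𝒜}
    (h : RedDer.mk (idealOf '' 𝒜) (euler K n) θ = RedDer.mk (idealOf '' 𝒜) (euler K n) θ') :
    derForm M θ.1 = derForm M θ'.1 := by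
  rw [← sub_eq_zero, ← map_sub, redDerMk_eq_zero_iff] at h
  obtain ⟨s, hs⟩ := h
  have : derForm M (θ.1 - θ'.1) = 0 := by
    have h2 : (θ - θ').1 = θ.1 - θ'.1 := rfl
    rw [← h2, ← hs, derForm_smul, hM.derForm_euler, mul_zero]
  rwa [map_sub, sub_eq_zero] at this

theorem derForm_eq_zero_of_derClass (hM : IsMinorMap L M) {θ : arrDer 𝒜}
    (h : derClassHom 𝒜 L θ = 0) : derForm M θ.1 = 0 := by
  rw [derClassHom_eq_zero_iff] at h
  -- Quantifying over all representatives of `y` lets the induction choose convenient ones; two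
  -- representatives differ by an Euler multiple, which has zero form.
  suffices H : ∀ y ∈ idealOf L • (⊤ : Submodule (Poly K n) (ArrRedDer 𝒜)), ∀ θ : arrDer 𝒜,
      RedDer.mk (idealOf '' 𝒜) (euler K n) θ = y → derForm M θ.1 = 0 from H _ h θ rfl
  intro y hy
  induction hy using Submodule.smul_induction_on' with
  | smul r hr m _ =>
    intro θ hθ
    obtain ⟨θ', rfl⟩ := redDerMk_surjective m
    rw [← map_smul] at hθ
    rw [hM.derForm_eq_of_redDerMk_eq hθ]
    change derForm M (r • θ'.1) = 0
    rw [derForm_smul, (subst_eq_zero_iff hM.range_eq).mpr hr, zero_mul]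
  | add y _ z _ hy hz =>
    intro θ hθ
    obtain ⟨θ₁, rfl⟩ := redDerMk_surjective y
    obtain ⟨θ₂, rfl⟩ := redDerMk_surjective z
    rw [← map_add] at hθ
    rw [hM.derForm_eq_of_redDerMk_eq hθ]
    change derForm M (θ₁.1 + θ₂.1) = 0
    rw [map_add, hy θ₁ rfl, hz θ₂ rfl, add_zero]

/-- `R` as an algebra over `S/I(L)`. -/
abbrev polyAlgebra (hM : IsMinorMap L M) : Algebra (CoordRing L) (Poly K n) :=
  ((algebraMap (FRing (perp L)) (Poly K n)).comp
    (hM.coordEquiv : CoordRing L →+* FRing (perp L))).toAlgebra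

theorem polyAlgebra_smul (hM : IsMinorMap L M) (s F : Poly K n) :
    letI := hM.polyAlgebra
    Ideal.Quotient.mk (idealOf L) s • F = subst M s * F := by
  let := hM.polyAlgebra
  rw [← hM.algebraMap_coordEquiv_mk]
  rfl

theorem exists_derForm_linearMap (hM : IsMinorMap L M) :
    letI := hM.polyAlgebra
    ∃ ψ : RedDerMod 𝒜 L →ₗ[CoordRing L] Poly K n,
      ∀ θ : arrDer 𝒜, ψ (derClass 𝒜 L θ) = derForm M θ.1 := by
  let := hM.polyAlgebra
  let g : arrDer 𝒜 →+ Poly K n := (derForm M).comp (arrDer 𝒜).subtype.toAddMonoidHom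
  let φ : RedDerMod 𝒜 L →+ Poly K n :=
    (derClassHom 𝒜 L).liftOfSurjective derClassHom_surjective
      ⟨g, fun θ hθ => hM.derForm_eq_zero_of_derClass hθ⟩
  have hφ : ∀ θ : arrDer 𝒜, φ (derClassHom 𝒜 L θ) = derForm M θ.1 := fun θ =>
    AddMonoidHom.liftOfRightInverse_comp_apply _ _ _
      ⟨g, fun θ hθ => hM.derForm_eq_zero_of_derClass hθ⟩ θ
  refine ⟨{ φ with map_smul' := fun r x => ?_ }, hφ⟩
  obtain ⟨s, rfl⟩ := Ideal.Quotient.mk_surjective r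
  obtain ⟨θ, rfl⟩ := derClassHom_surjective x
  change φ (_ • derClassHom 𝒜 L θ) = Ideal.Quotient.mk (idealOf L) s • φ (derClassHom 𝒜 L θ)
  rw [← derClassHom_smul, hφ, hφ, hM.polyAlgebra_smul]
  exact derForm_smul M s θ.1

end IsMinorMap

end DerClass

/-! ### Local injectivity and local surjectivity along the line -/

namespace IsMinorMap

variable {K : Type*} [Field K] {n : ℕ} {Z : Set (ℙ K (Vec K n))}
  {L : Submodule K (Vec K n)} {M : Vec K n →ₗ[K] Vec K n}

theorem derClassHom_smul_of_mem {b : Poly K n} (hb : b ∈ idealOf L) {𝒜 : Set (Submodule K (Vec K n))}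
    (θ : arrDer 𝒜) : derClassHom 𝒜 L (b • θ) = 0 := by
  rw [derClassHom_smul, Ideal.Quotient.eq_zero_iff_mem.mpr hb]
  exact zero_smul (CoordRing L) (derClassHom 𝒜 L θ)

theorem linForm_rep_notMem (hT : IsTransversal Z L) {P : ℙ K (Vec K n)} (hP : P ∈ Z) :
    linForm P.rep ∉ idealOf L := by
  intro h
  obtain ⟨u, hu, huP⟩ := hT.exists_mem P hP
  have := linForm_mem_idealOf.mp h u hu
  rw [dotProduct_comm, huP] at this
  exact one_ne_zero this

section Infinite

variable [Infinite K]

/-- A logarithmic derivation whose components vanish on `L` is locally in `I(L) D`. -/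
theorem exists_smul_derClassHom_eq_zero (hT : IsTransversal Z L) (hZ : Z.Finite)
    {θ : arrDer (dualArrangement Z)} (hθ : ∀ i, θ.1 (MvPolynomial.X i) ∈ idealOf L)
    {x : Vec K n} (hx : x ∈ L) (hx0 : x ≠ 0) : ∃ s : Poly K n, MvPolynomial.eval x s ≠ 0 ∧
      derClassHom (dualArrangement Z) L (s • θ) = 0 := by
  classical
  rcases hT.eval_prod_ne_zero hZ hx hx0 with h | ⟨P, hP, h⟩
  · refine ⟨_, h, ?_⟩
    set s := ∏ P ∈ hZ.toFinset, linForm P.rep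
    -- Away from all hyperplanes the multiples `s ∂_i` are logarithmic, so `s θ` is a combination of
    -- elements of `D(𝒜)` with coefficients in `I(L)`.
    have h1 : s • θ = ∑ i, θ.1 (MvPolynomial.X i) •
        (⟨s • constDer (Pi.single i 1), prod_smul_mem hZ _⟩ : arrDer (dualArrangement Z)) := by
      refine Subtype.ext ?_
      simp only [SetLike.val_smul, AddSubmonoidClass.coe_finsetSum]
      conv_lhs => rw [eq_sum_constDer θ.1, Finset.smul_sum]
      exact Finset.sum_congr rfl fun i _ => smul_comm _ _ _
    rw [h1, map_sum]
    exact Finset.sum_eq_zero fun i _ => derClassHom_smul_of_mem (hθ i) _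
  · refine ⟨_, h, ?_⟩
    set s := ∏ P' ∈ hZ.toFinset.erase P, linForm P'.rep
    obtain ⟨c, hc⟩ := exists_dotProduct_eq_one P.rep_nonzero
    obtain ⟨b, hb⟩ := mem_arrDer_iff.mp θ.2 P hP
    -- On `P^⊥`, `D(𝒜)` is locally generated by the tangent fields and `ℓ_P ∂_c`, with `ℓ_P` the
    -- equation of `P^⊥`. The coefficient `b` of the latter is in `I(L)`, because `ℓ_P b` is and
    -- `ℓ_P` is nonzero on `L`.
    have hbL : b ∈ idealOf L := by
      refine ((isPrime_idealOf L).mem_or_mem (x := linForm P.rep) ?_).resolve_left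
        (linForm_rep_notMem hT hP)
      rw [← hb, derivation_linForm]
      exact sum_mem fun i _ => Ideal.mul_mem_left _ _ (hθ i)
    have hmem1 : ∀ i, s • constDer (Pi.single i 1 - P.rep i • c) ∈ arrDer (dualArrangement Z) := by
      intro i
      refine prod_erase_smul_mem hZ ?_
      rw [constDer_linForm, sub_dotProduct, smul_dotProduct, hc]
      simp
    have hmem2 : s • (linForm P.rep • constDer c) ∈ arrDer (dualArrangement Z) :=
      prod_erase_smul_mem hZ (Dvd.intro _ rfl)
    have h1 : s • θ = ∑ i, θ.1 (MvPolynomial.X i) •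
        (⟨_, hmem1 i⟩ : arrDer (dualArrangement Z)) + b • ⟨_, hmem2⟩ := by
      refine Subtype.ext ?_
      simp only [SetLike.val_smul, AddSubmonoidClass.coe_finsetSum, Submodule.coe_add]
      conv_lhs => rw [eq_sum_constDer_add θ.1 P.rep c, smul_add, Finset.smul_sum, hb]
      refine congrArg₂ _ (Finset.sum_congr rfl fun i _ => smul_comm _ _ _) ?_
      simp only [smul_smul]
      congr 1
      ring
    rw [h1, map_add, map_sum, derClassHom_smul_of_mem hbL, add_zero]
    exact Finset.sum_eq_zero fun i _ => derClassHom_smul_of_mem (hθ i) _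

/-- Vanishing of the form at `P` says that the value of the derivation `θ₀` on the equation of `P^⊥`
vanishes at `M P`, hence on all of `L ∩ P^⊥`. That value is then a multiple of the equation plus
some `b ∈ I(L)`; subtracting `b ∂_c` makes `θ₀` tangent to `P^⊥` without changing its form, and `s`
takes care of the other hyperplanes. -/
theorem exists_derForm_eq_of_dualForm (hM : IsMinorMap L M) (hL : Module.finrank K L = 2)
    (hT : IsTransversal Z L) (hZ : Z.Finite) {f : Fin (n + 2) → Poly K n}
    (hf : dualForm M f ∈ idealOfPoints Z) {x : Vec K n} (hx : x ∈ L) (hx0 : x ≠ 0) :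
    ∃ s : Poly K n, MvPolynomial.eval x s ≠ 0 ∧ ∃ θ : arrDer (dualArrangement Z),
      derForm M θ.1 = subst M s * dualForm M f := by
  classical
  let θ₀ : Derivation K (Poly K n) (Poly K n) := MvPolynomial.mkDerivation K f
  have hθ₀ : derForm M θ₀ = dualForm M f := by
    rw [derForm_apply]
    simp only [θ₀, MvPolynomial.mkDerivation_X]
  rcases hT.eval_prod_ne_zero hZ hx hx0 with h | ⟨P, hP, h⟩
  · refine ⟨_, h, ⟨_, prod_smul_mem hZ θ₀⟩, ?_⟩
    rw [derForm_smul, hθ₀]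
  · refine ⟨_, h, ?_⟩
    obtain ⟨u, hu, huP⟩ := hT.exists_mem P hP
    obtain ⟨c, hc⟩ := exists_dotProduct_eq_one P.rep_nonzero
    have hMP : M P.rep ≠ 0 := by
      rw [Ne, hM.eq_zero_iff]
      intro h0
      have := h0 u hu
      rw [dotProduct_comm, huP] at this
      exact one_ne_zero this
    have hvan : ∀ y ∈ L, y ⬝ᵥ P.rep = 0 → MvPolynomial.eval y (θ₀ (linForm P.rep)) = 0 := by
      obtain ⟨i, hi⟩ := Function.ne_iff.mp hMP
      -- Evaluating the form at `r P` gives the wanted value at `r M P` times `r`. The factor `r` is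
      -- matched by a coordinate `X i` that is nonzero at `M P`, and primality removes it.
      have key : θ₀ (linForm P.rep) ∈ idealOf (Submodule.span K {M P.rep}) := by
        refine ((isPrime_idealOf (Submodule.span K {M P.rep})).mem_or_mem
          (y := MvPolynomial.X i) ?_).resolve_right ?_
        · intro y hy
          obtain ⟨r, rfl⟩ := Submodule.mem_span_singleton.mp hy
          have hPF : dualForm M f ∈ idealOf P.submodule := by
            simpa [idealOfPoints] using (Submodule.mem_iInf _).mp
              ((Submodule.mem_iInf _).mp hf P) hP
          have h1 : MvPolynomial.eval (r • P.rep) (dualForm M f) = 0 := by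
            refine hPF _ ?_
            rw [P.submodule_eq]
            exact Submodule.smul_mem _ _ (Submodule.mem_span_singleton_self _)
          rw [eval_dualForm, map_smul, dotProduct_smul, smul_eq_mul] at h1
          change MvPolynomial.eval _ _ = _
          rw [derivation_linForm, map_mul, map_sum, MvPolynomial.eval_X]
          simp only [θ₀, MvPolynomial.mkDerivation_X, map_mul, MvPolynomial.eval_C]
          rw [Finset.sum_congr rfl fun j _ => mul_comm _ _]
          change ((fun j => MvPolynomial.eval (r • M P.rep) (f j)) ⬝ᵥ P.rep) * _ = _
          rw [Pi.smul_apply, smul_eq_mul]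
          linear_combination (M P.rep i) * h1
        · intro h0
          have : MvPolynomial.eval (M P.rep) (MvPolynomial.X i) = 0 :=
            h0 _ (Submodule.mem_span_singleton_self _)
          rw [MvPolynomial.eval_X] at this
          exact hi this
      intro y hy hyP
      obtain ⟨r, rfl⟩ := exists_eq_smul hL hu huP (hM.mem P.rep) (hM.dot_self _) hMP hy hyP
      exact key _ (Submodule.smul_mem _ _ (Submodule.mem_span_singleton_self _))
    obtain ⟨b, hb, hbP⟩ := exists_sub_mem_idealOf hu huP hvan
    rw [idealOf_perp_singleton, Ideal.mem_span_singleton] at hbP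
    have hdvd : linForm P.rep ∣ (θ₀ - b • constDer c) (linForm P.rep) := by
      rw [Derivation.sub_apply, Derivation.smul_apply, constDer_linForm, hc, map_one, smul_eq_mul,
        mul_one]
      exact hbP
    refine ⟨⟨_, prod_erase_smul_mem hZ hdvd⟩, ?_⟩
    rw [derForm_smul, map_sub, derForm_smul, hθ₀, (subst_eq_zero_iff hM.range_eq).mpr hb, zero_mul,
      sub_zero]

theorem subst_linForm (hM : IsMinorMap L M) (c : Vec K n) :
    subst M (linForm c) = linForm (-M c) := by
  refine MvPolynomial.funext fun v => ?_
  rw [eval_subst, eval_linForm, eval_linForm, neg_dotProduct, dotProduct_comm, hM.dot_swap]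

end Infinite

/-- A derivation with zero form is an Euler multiple up to components in `I(L)`. Removing that
multiple leaves the class unchanged; the annihilator of the class then has no common zero on `L`
outside the origin. -/
theorem exists_pow_smul_derClassHom_eq_zero [IsAlgClosed K] (hM : IsMinorMap L M)
    (hL : Module.finrank K L = 2) (hT : IsTransversal Z L) (hZ : Z.Finite)
    {θ : arrDer (dualArrangement Z)} (hθ : derForm M θ.1 = 0) {g : Poly K n} {e : ℕ} (he : 0 < e)
    (hg : g.IsHomogeneous e) :
    ∃ c : ℕ, Ideal.Quotient.mk (idealOf L) g ^ c • derClassHom (dualArrangement Z) L θ = 0 := by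
  obtain ⟨u, hu⟩ := hM.exists_of_dualForm_eq_zero hL hθ
  let ε : arrDer (dualArrangement Z) := ⟨euler K n, euler_mem_arrDer⟩
  have h1 : derClassHom (dualArrangement Z) L θ =
      derClassHom (dualArrangement Z) L (θ - u • ε) := by
    conv_lhs => rw [← sub_add_cancel θ (u • ε), map_add,
      derClassHom_eq_zero_of_euler (θ := u • ε) (s := u) rfl]
    exact add_zero _
  rw [h1]
  set x := derClassHom (dualArrangement Z) L (θ - u • ε) with hx
  let J : Ideal (Poly K n) := Ideal.comap (Ideal.Quotient.mk (idealOf L))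
    (LinearMap.ker (LinearMap.toSpanSingleton (CoordRing L) _ x))
  have hJ : ∀ s, s ∈ J ↔ Ideal.Quotient.mk (idealOf L) s • x = 0 := fun s => Iff.rfl
  obtain ⟨c, hc⟩ := exists_pow_mem (J := J) (L := L)
    (fun s hs => by 
      rw [hJ, Ideal.Quotient.eq_zero_iff_mem.mpr hs]
      exact zero_smul (CoordRing L) x) (by
      intro y hy hy0
      obtain ⟨s, hs, hsx⟩ := exists_smul_derClassHom_eq_zero (θ := θ - u • ε) hT hZ (fun i => by
        have := hu i
        change (θ.1 - u • euler K n) (MvPolynomial.X i) ∈ _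
        rwa [Derivation.sub_apply, Derivation.smul_apply, euler_X, smul_eq_mul]) hy hy0
      refine ⟨s, ?_, hs⟩
      rw [hJ, hx, ← derClassHom_smul, hsx]) he hg
  refine ⟨c, ?_⟩
  rw [hJ, map_pow] at hc
  exact hc

end IsMinorMap

/-! ### The graded pieces on the dual side and their local description -/

section DualPart

variable {K : Type*} [Field K] {n : ℕ} {Z : Set (ℙ K (Vec K n))}

theorem mem_idealOfPoints {F : Poly K n} :
    F ∈ idealOfPoints Z ↔ ∀ P ∈ Z, F ∈ idealOf P.submodule := by
  rw [idealOfPoints]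
  simp only [Submodule.mem_iInf]

theorem mem_dualPart_add_one {Q : Submodule K (Vec K n)} {d : ℤ} {F : Poly K n} :
    F ∈ dualPart Z Q (d + 1) ↔
      F ∈ idealOfPoints Z ∧ F ∈ idealOf Q ^ d.toNat ∧ F ∈ homogeneousPart (d + 1) := by
  have h : F ∈ dualPart Z Q (d + 1) ↔ (F ∈ idealOfPoints Z ∧ F ∈ idealOf Q ^ (d + 1 - 1).toNat) ∧
      F ∈ homogeneousPart (d + 1) := Iff.rfl
  rw [h, and_assoc, add_sub_cancel_right]

theorem mul_mem_dualPart {Q : Submodule K (Vec K n)} {d : ℤ} {F a : Poly K n} {k : ℕ}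
    (ha : a.IsHomogeneous k) (haQ : a ∈ idealOf Q ^ k) (hF : F ∈ dualPart Z Q (d + 1)) :
    a * F ∈ dualPart Z Q (k + d + 1) := by
  rw [mem_dualPart_add_one] at hF ⊢
  refine ⟨Ideal.mul_mem_left _ _ hF.1, ?_, ?_⟩
  · have h := Ideal.mul_mem_mul haQ hF.2.1
    rw [← pow_add] at h
    -- Truncation is harmless: `(k + d).toNat ≤ k + d.toNat` also for negative `d`.
    exact Ideal.pow_le_pow_right (by omega) h
  · rw [add_assoc]
    exact mul_mem_homogeneousPart ha hF.2.2

end DualPart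

namespace IsMinorMap

variable {K : Type*} [Field K] {n : ℕ} {Z : Set (ℙ K (Vec K n))}
  {L : Submodule K (Vec K n)} {M : Vec K n →ₗ[K] Vec K n}

section Infinite

variable [Infinite K]

/-- Because `M P ⬝ᵥ P = 0`, the equation of `P^⊥` vanishes at `M P`. Evaluating the logarithmic
condition there gives the vanishing of the form at `P`. -/
theorem derForm_mem_dualPart (hM : IsMinorMap L M) {d : ℤ} (θ : arrDer (dualArrangement Z))
    (hθ : ∀ i, θ.1 (MvPolynomial.X i) ∈ homogeneousPart d) :
    derForm M θ.1 ∈ dualPart Z (perp L) (d + 1) := by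
  rw [mem_dualPart_add_one]
  rcases lt_or_ge d 0 with hd | hd
  · have h : derForm M θ.1 = 0 := by
      rw [derForm_apply, dualForm_apply]
      exact Finset.sum_eq_zero fun i _ => by
        rw [(mem_homogeneousPart_of_neg hd).mp (hθ i), map_zero, zero_mul]
    rw [h]
    exact ⟨zero_mem _, zero_mem _, zero_mem _⟩
  · lift d to ℕ using hd
    refine ⟨mem_idealOfPoints.mpr fun P hP => ?_, ?_, ?_⟩
    · intro x hx
      rw [P.submodule_eq] at hx
      obtain ⟨r, rfl⟩ := Submodule.mem_span_singleton.mp hx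
      change MvPolynomial.eval _ _ = _
      rw [derForm_apply, eval_dualForm, dotProduct_smul]
      obtain ⟨g, hg⟩ := mem_arrDer_iff.mp θ.2 P hP
      have h1 := congrArg (MvPolynomial.eval (M (r • P.rep))) hg
      rw [map_mul, eval_linForm, map_smul, dotProduct_smul, dotProduct_comm P.rep, hM.dot_self,
        smul_zero, zero_mul, derivation_linForm, map_sum] at h1
      simp only [map_mul, MvPolynomial.eval_C] at h1
      rw [Finset.sum_congr rfl fun j _ => mul_comm _ _] at h1
      rw [map_smul]
      exact smul_eq_zero_of_right r h1
    · rw [derForm_apply, dualForm_apply]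
      exact sum_mem fun i _ => Ideal.mul_mem_right _ _ (hM.subst_mem_pow (hθ i))
    · rw [derForm_apply, dualForm_apply]
      exact MvPolynomial.IsHomogeneous.sum _ _ _ fun i _ =>
        (isHomogeneous_subst M (hθ i)).mul (MvPolynomial.isHomogeneous_X K i)

/-- Membership in the graded pieces of `I_Q^≫(Z)` can be tested locally on `L`. -/
theorem mem_dualPart_of_forall (hM : IsMinorMap L M) (hL : Module.finrank K L = 2)
    (hT : IsTransversal Z L) {d : ℤ} {F : Poly K n}
    (hF : ∀ c : Vec K n, c ∉ perp L →
      ∃ k : ℕ, subst M (linForm c) ^ k * F ∈ dualPart Z (perp L) (d + k + 1)) :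
    F ∈ dualPart Z (perp L) (d + 1) := by
  have hne : ∀ c, c ∉ perp L → -M c ≠ 0 := fun c hc => by
    rw [neg_ne_zero, Ne, hM.eq_zero_iff]; exact hc
  obtain ⟨u, v, a, b, hc⟩ := exists_lineCoords hL
  have ha : a ∉ perp L := fun h => by
    have := h u hc.left_mem
    rw [dotProduct_comm, hc.left_left] at this
    exact one_ne_zero this
  obtain ⟨k, hk⟩ := hF a ha
  rw [hM.subst_linForm, mem_dualPart_add_one] at hk
  rw [mem_dualPart_add_one]
  refine ⟨mem_idealOfPoints.mpr fun P hP => ?_, ?_, ?_⟩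
  · have hMP : M P.rep ≠ 0 := by
      obtain ⟨u, hu, huP⟩ := hT.exists_mem P hP
      rw [Ne, hM.eq_zero_iff]
      intro h0
      have := h0 u hu
      rw [dotProduct_comm, huP] at this
      exact one_ne_zero this
    -- Each point of `Z` needs its own multiplier, one that is nonzero at `M P` and so can be
    -- cancelled modulo the prime ideal of `P`. For the power of `I(Q)` and the degree the single
    -- form of `a` suffices.
    obtain ⟨c, hcP⟩ := exists_dotProduct_eq_one hMP
    have hcL : c ∉ perp L := fun h => by
      rw [h _ (hM.mem P.rep)] at hcP
      exact zero_ne_one hcP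
    obtain ⟨k, hk⟩ := hF c hcL
    have h1 := mem_idealOfPoints.mp (mem_dualPart_add_one.mp hk).1 P hP
    refine ((isPrime_idealOf P.submodule).mem_or_mem h1).resolve_left fun h2 => ?_
    have h3 := (isPrime_idealOf P.submodule).mem_of_pow_mem k h2
    have h4 : MvPolynomial.eval P.rep (subst M (linForm c)) = 0 := h3 _ (by
      rw [P.submodule_eq]
      exact Submodule.mem_span_singleton_self _)
    rw [eval_subst, eval_linForm, hcP] at h4
    exact one_ne_zero h4
  · rcases lt_or_ge d 0 with hd | hd
    · rw [Int.toNat_of_nonpos hd.le, pow_zero, Ideal.one_eq_top]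
      trivial
    · refine mem_idealOf_pow_of_pow_mul_mem (perp L) (c := -M a) (k := k) ?_ (hne a ha) ?_
      · rw [perp_perp]; exact L.neg_mem (hM.mem a)
      · have h1 := hk.2.1
        rwa [Int.toNat_add hd (by positivity), Int.toNat_natCast] at h1
  · have h1 := (isHomogeneous_linForm (-M a)).pow k
    rw [one_mul] at h1
    rw [← mul_mem_homogeneousPart_iff h1 (pow_ne_zero k (linForm_ne_zero (hne a ha)))]
    convert hk.2.2 using 2
    ring

end Infinite

/-- The elements of the graded pieces of `I_Q^≫(Z)` come locally from derivations. -/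
theorem exists_derForm_eq_pow_mul [IsAlgClosed K] (hM : IsMinorMap L M)
    (hL : Module.finrank K L = 2) (hT : IsTransversal Z L) (hZ : Z.Finite) {d : ℤ} {F : Poly K n}
    (hF : F ∈ dualPart Z (perp L) (d + 1)) {g : Poly K n} {e : ℕ} (he : 0 < e)
    (hg : g.IsHomogeneous e) : ∃ (k : ℕ) (θ : arrDer (dualArrangement Z)),
      (∀ i, θ.1 (MvPolynomial.X i) ∈ homogeneousPart (d + k * e)) ∧
        derForm M θ.1 = subst M g ^ k * F := by
  rcases lt_or_ge (d + 1) 0 with hd | hd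
  · have h0 := (mem_homogeneousPart_of_neg hd).mp (mem_dualPart_add_one.mp hF).2.2
    refine ⟨0, 0, fun i => zero_mem _, ?_⟩
    rw [h0, mul_zero]
    exact map_zero _
  obtain ⟨m, hm⟩ := Int.eq_ofNat_of_zero_le hd
  -- For `d = -1` the form `F` itself need not come from a tuple. Multiplication by `M_i` raises `d`
  -- to `d + 1 ≥ 0`, where it does.
  have hloc : ∀ i, ∃ f : Fin (n + 2) → Poly K n,
      dualForm M f = subst M (MvPolynomial.X i) * F := by
    intro i
    have h1 := mul_mem_dualPart (isHomogeneous_subst M (MvPolynomial.isHomogeneous_X K i))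
      (hM.subst_mem_pow (MvPolynomial.isHomogeneous_X K i)) hF
    rw [mem_dualPart_add_one] at h1
    have e1 : ((1 : ℕ) : ℤ) + d = m := by push_cast; linarith
    rw [e1, Int.toNat_natCast] at h1
    obtain ⟨f, -, hf⟩ := hM.exists_dualForm_eq h1.2.1 h1.2.2
    exact ⟨f, hf⟩
  -- The ideal of the multipliers that make `F` the form of a logarithmic derivation; it contains
  -- `I(L)` through the zero derivation.
  let J : Ideal (Poly K n) :=
    { carrier := {s | ∃ θ : arrDer (dualArrangement Z), derForm M θ.1 = subst M s * F}
      add_mem' := by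
        rintro s t ⟨θ, hθ⟩ ⟨θ', hθ'⟩
        refine ⟨θ + θ', ?_⟩
        rw [Submodule.coe_add, map_add, hθ, hθ', map_add, add_mul]
      zero_mem' := ⟨0, by rw [map_zero, zero_mul]; exact map_zero _⟩
      smul_mem' := by
        rintro s t ⟨θ, hθ⟩
        refine ⟨s • θ, ?_⟩
        rw [SetLike.val_smul, derForm_smul, hθ, smul_eq_mul, map_mul, mul_assoc] }
  obtain ⟨c, hc⟩ := exists_pow_mem (J := J) (L := L)
    (fun s hs => ⟨0, by
      rw [(subst_eq_zero_iff hM.range_eq).mpr hs, zero_mul]; exact map_zero _⟩) (by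
      intro y hy hy0
      obtain ⟨i, hi⟩ := Function.ne_iff.mp hy0
      obtain ⟨f, hf⟩ := hloc i
      obtain ⟨s, hs, θ, hθ⟩ := hM.exists_derForm_eq_of_dualForm (f := f) hL hT hZ (by
        rw [hf]; exact Ideal.mul_mem_left _ _ (mem_dualPart_add_one.mp hF).1) hy hy0
      refine ⟨s * MvPolynomial.X i, ⟨θ, ?_⟩, ?_⟩
      · rw [hθ, hf, map_mul, mul_assoc]
      · rw [map_mul, MvPolynomial.eval_X]
        exact mul_ne_zero hs hi) he hg
  -- The extra factor `g` ensures that `d + (c + 1) e` is nonnegative even for `d = -1`, so that a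
  -- component of this degree can be taken.
  obtain ⟨θ, hθ⟩ : g ^ (c + 1) ∈ J := by
    rw [pow_succ']
    exact J.mul_mem_left g hc
  have hpos : 0 ≤ d + ((c + 1 : ℕ) : ℤ) * e := by
    have h1 : (1 : ℤ) ≤ ((c + 1 : ℕ) : ℤ) * e := by
      exact_mod_cast Nat.mul_pos c.succ_pos he
    omega
  obtain ⟨j, hj⟩ := Int.eq_ofNat_of_zero_le hpos
  -- The target form is homogeneous of degree `j + 1`, so only the component of degree `j` of `θ`
  -- contributes to it.
  refine ⟨c + 1, ⟨derComponent j θ.1, derComponent_mem j θ.2⟩, fun i => ?_, ?_⟩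
  · rw [hj]
    change derComponent j θ.1 (MvPolynomial.X i) ∈ _
    rw [derComponent_X]
    exact MvPolynomial.homogeneousComponent_isHomogeneous _ _
  · change derForm M (derComponent j θ.1) = _
    rw [derForm_derComponent, hθ, map_pow]
    refine homogeneousComponent_of_mem_homogeneousPart ?_
    have h1 := mul_mem_homogeneousPart ((isHomogeneous_subst M hg).pow (c + 1))
      (mem_dualPart_add_one.mp hF).2.2
    convert h1 using 2
    push_cast at hj ⊢
    linear_combination -hj

end IsMinorMap

/-! ### Transversality is an open nonempty condition -/

section GeneralLine

variable {K : Type*} [Field K] {n : ℕ}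

/-- The pairing of the `i`-th vector of a pair with the vector `a`, as a polynomial in the
coordinates of the pair. -/
def pairing (i : Fin 2) (a : Vec K n) : MvPolynomial (Fin 2 × Fin (n + 2)) K :=
  ∑ j, MvPolynomial.X (i, j) * MvPolynomial.C (a j)

theorem eval_pairing (i : Fin 2) (a : Vec K n) (u : Fin 2 → Vec K n) :
    MvPolynomial.eval (fun ij => u ij.1 ij.2) (pairing i a) = u i ⬝ᵥ a := by
  simp [pairing, dotProduct]

/-- The determinant of the pairings of a pair of vectors with `a` and `b`. -/
def pairingDet (a b : Vec K n) : MvPolynomial (Fin 2 × Fin (n + 2)) K :=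
  pairing 0 a * pairing 1 b - pairing 1 a * pairing 0 b

theorem pairing_ne_zero (i : Fin 2) {a : Vec K n} (ha : a ≠ 0) : pairing i a ≠ 0 := by
  intro h
  obtain ⟨c, hc⟩ := exists_dotProduct_eq_one ha
  have h1 := eval_pairing i a fun _ => c
  rw [h, map_zero, hc] at h1
  exact zero_ne_one h1

theorem pairingDet_ne_zero {a b : Vec K n} (ha : a ≠ 0) (hb : b ∉ Submodule.span K {a}) :
    pairingDet a b ≠ 0 := by
  intro h
  obtain ⟨c, hc⟩ := exists_dotProduct_eq_one ha
  rw [← perp_perp (Submodule.span K {a}), mem_perp] at hb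
  push Not at hb
  obtain ⟨v, hv, hbv⟩ := hb
  have := congrArg (MvPolynomial.eval fun ij => (![c, v] : Fin 2 → Vec K n) ij.1 ij.2) h
  rw [pairingDet, map_sub, map_mul, map_mul, eval_pairing, eval_pairing, eval_pairing,
    eval_pairing, map_zero] at this
  simp only [Matrix.cons_val_zero, Matrix.cons_val_one] at this
  rw [hc, mem_perp_singleton.mp hv, zero_mul, sub_zero, one_mul, dotProduct_comm] at this
  exact hbv this

theorem rep_notMem_span {P P' : ℙ K (Vec K n)} (h : P ≠ P') :
    P'.rep ∉ Submodule.span K {P.rep} := by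
  intro hmem
  obtain ⟨r, hr⟩ := Submodule.mem_span_singleton.mp hmem
  refine h ?_
  rw [← P.mk_rep, ← P'.mk_rep, eq_comm, Projectivization.mk_eq_mk_iff']
  exact ⟨r, hr⟩

/-- The first factors keep the first spanning vector off every hyperplane. The determinants for
pairs of distinct points keep the two equations independent on `L`. Finiteness of `Z` makes this one
nonzero polynomial. -/
theorem holdsForGeneralLine_of_isTransversal {Z : Set (ℙ K (Vec K n))} (hZ : Z.Finite)
    {p : Submodule K (Vec K n) → Prop}
    (hp : ∀ L : Submodule K (Vec K n), Module.finrank K L = 2 → IsTransversal Z L → p L) : HoldsForGeneralLine p := by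
  classical
  refine ⟨(∏ P ∈ hZ.toFinset, pairing 0 P.rep) *
    ∏ P ∈ hZ.toFinset.offDiag, pairingDet P.1.rep P.2.rep, ?_, fun u hu hG => hp _ ?_ ⟨?_, ?_⟩⟩
  · refine mul_ne_zero (Finset.prod_ne_zero_iff.mpr fun P _ => pairing_ne_zero 0 P.rep_nonzero)
      (Finset.prod_ne_zero_iff.mpr fun P hP => pairingDet_ne_zero P.1.rep_nonzero ?_)
    exact rep_notMem_span (Finset.mem_offDiag.mp hP).2.2
  · rw [finrank_span_eq_card hu, Fintype.card_fin]
  · intro P hP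
    rw [map_mul, map_prod] at hG
    have h := Finset.prod_ne_zero_iff.mp (left_ne_zero_of_mul hG) P (hZ.mem_toFinset.mpr hP)
    rw [eval_pairing] at h
    refine ⟨(u 0 ⬝ᵥ P.rep)⁻¹ • u 0,
      Submodule.smul_mem _ _ (Submodule.subset_span ⟨0, rfl⟩), ?_⟩
    rw [smul_dotProduct, smul_eq_mul, inv_mul_cancel₀ h]
  · intro P hP P' hP' hne x hx h1 h2
    rw [map_mul, map_prod, map_prod] at hG
    have h := Finset.prod_ne_zero_iff.mp (right_ne_zero_of_mul hG) (P, P')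
      (Finset.mem_offDiag.mpr ⟨hZ.mem_toFinset.mpr hP, hZ.mem_toFinset.mpr hP', hne⟩)
    rw [pairingDet, map_sub, map_mul, map_mul, eval_pairing, eval_pairing, eval_pairing,
      eval_pairing] at h
    obtain ⟨c, rfl⟩ := (Submodule.mem_span_range_iff_exists_fun K).mp hx
    rw [Fin.sum_univ_two, add_dotProduct, smul_dotProduct, smul_dotProduct, smul_eq_mul,
      smul_eq_mul] at h1 h2
    have e0 : c 0 = 0 := by
      refine (mul_eq_zero.mp ?_).resolve_right h
      linear_combination (u 1 ⬝ᵥ P'.rep) * h1 - (u 1 ⬝ᵥ P.rep) * h2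
    have e1 : c 1 = 0 := by
      refine (mul_eq_zero.mp ?_).resolve_right h
      linear_combination (u 0 ⬝ᵥ P.rep) * h2 - (u 0 ⬝ᵥ P'.rep) * h1
    simp [Fin.sum_univ_two, e0, e1]

end GeneralLine

/-! ### The graded structure of the dual module -/

section DualModule

variable {K : Type*} [Field K] {n : ℕ} {Z : Set (ℙ K (Vec K n))}

theorem dualPart_le_dualModule (Q : Submodule K (Vec K n)) (d : ℤ) {F : Poly K n}
    (hF : F ∈ dualPart Z Q d) : F ∈ dualModule Z Q :=
  Submodule.subset_span (Set.mem_iUnion.mpr ⟨d, hF⟩)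

/-- The sum of the pieces is already stable under `ℱ_Q`: a linear form vanishing on `Q` raises both
the degree and the exponent of `I(Q)` by one. Hence passing to the span creates no new homogeneous
elements. -/
theorem homogeneousComponent_mem_dualPart (Q : Submodule K (Vec K n)) {F : Poly K n}
    (hF : F ∈ dualModule Z Q) (j : ℕ) :
    MvPolynomial.homogeneousComponent j F ∈ dualPart Z Q j := by
  have hsmul : ∀ (a : FRing Q) (F : Poly K n),
      (∀ j : ℕ, MvPolynomial.homogeneousComponent j F ∈ dualPart Z Q j) →
      ∀ j : ℕ, MvPolynomial.homogeneousComponent j (a • F) ∈ dualPart Z Q j := by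
    intro a
    induction a using SymmetricAlgebra.induction with
    | algebraMap r =>
      intro F hF j
      have : algebraMap K (FRing Q) r • F = r • F := by
        rw [Algebra.smul_def, Algebra.smul_def]
        congr 1
        exact (SymmetricAlgebra.lift (linearForms Q).subtype).commutes r
      rw [this, map_smul]
      exact Submodule.smul_mem _ _ (hF j)
    | ι x =>
      intro F hF j
      rw [Algebra.smul_def, algebraMap_FRing_ι]
      have hx : (x : Poly K n).IsHomogeneous 1 := x.2.2
      rcases j with _ | j
      · rw [homogeneousComponent_mul_of_lt hx one_pos]
        exact zero_mem _
      · rw [add_comm j 1, homogeneousComponent_add_mul hx]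
        have h := hF j
        rw [← sub_add_cancel (j : ℤ) 1] at h
        have h2 := mul_mem_dualPart hx (by rw [pow_one]; exact x.2.1) h
        convert h2 using 2
        push_cast
        ring
    | mul a b ha hb =>
      intro F hF
      rw [mul_smul]
      exact ha _ (hb F hF)
    | add a b ha hb =>
      intro F hF j
      rw [add_smul, map_add]
      exact add_mem (ha F hF j) (hb F hF j)
  revert j
  induction hF using Submodule.span_induction with
  | mem F h =>
    obtain ⟨d, hd⟩ := Set.mem_iUnion.mp h
    intro j
    by_cases hjd : (j : ℤ) = d
    · subst hjd
      rw [homogeneousComponent_of_mem_homogeneousPart hd.2]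
      exact hd
    · rw [mem_homogeneousPart_iff.mp hd.2 j hjd]
      exact zero_mem _
  | zero => intro j; rw [map_zero]; exact zero_mem _
  | add x y _ _ hx hy => intro j; rw [map_add]; exact add_mem (hx j) (hy j)
  | smul a x _ hx => exact hsmul a x hx

theorem dualModule_inter_homogeneousPart (Q : Submodule K (Vec K n)) (d : ℤ) :
    {F | F ∈ dualModule Z Q ∧ F ∈ homogeneousPart d} = (dualPart Z Q d : Set (Poly K n)) := by
  ext F
  refine ⟨fun ⟨h1, h2⟩ => ?_, fun h => ⟨dualPart_le_dualModule Q d h, h.2⟩⟩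
  rcases lt_or_ge d 0 with hd | hd
  · rw [(mem_homogeneousPart_of_neg hd).mp h2]
    exact zero_mem _
  · lift d to ℕ using hd
    have := homogeneousComponent_mem_dualPart Q h1 d
    rwa [homogeneousComponent_of_mem_homogeneousPart h2] at this

theorem algebraMap_mem_of_mem_fRingPart (Q : Submodule K (Vec K n)) {i : ℕ} {a : FRing Q}
    (ha : a ∈ fRingPart Q i) : (algebraMap (FRing Q) (Poly K n) a).IsHomogeneous i ∧
      algebraMap (FRing Q) (Poly K n) a ∈ idealOf Q ^ i := by
  rw [fRingPart] at ha
  induction ha using Submodule.pow_induction_on_left' with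
  | algebraMap r =>
    have : algebraMap (FRing Q) (Poly K n) (algebraMap K (FRing Q) r) = MvPolynomial.C r :=
      (SymmetricAlgebra.lift (linearForms Q).subtype).commutes r
    rw [this, pow_zero, Ideal.one_eq_top]
    exact ⟨MvPolynomial.isHomogeneous_C _ r, trivial⟩
  | add x y i _ _ hx hy =>
    rw [map_add]
    exact ⟨hx.1.add hy.1, add_mem hx.2 hy.2⟩
  | mem_mul m hm i x _ hx =>
    obtain ⟨y, rfl⟩ := hm
    rw [map_mul, algebraMap_FRing_ι, Nat.succ_eq_one_add]
    refine ⟨MvPolynomial.IsHomogeneous.mul y.2.2 hx.1, ?_⟩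
    rw [pow_add, pow_one]
    exact Ideal.mul_mem_mul y.2.1 hx.2

end DualModule

/-! ### The embedding of the section module and its values -/

namespace IsMinorMap

variable {K : Type*} [Field K] {n : ℕ} {Z : Set (ℙ K (Vec K n))}
  {L : Submodule K (Vec K n)} {M : Vec K n →ₗ[K] Vec K n}

/-- The class of a linear form in `S/I(L)`, as an element of positive degree. -/
def linClass (L : Submodule K (Vec K n)) (c : Vec K n) : PosHomogeneous (coordRingPart L) where
  deg := 1
  elt := Ideal.Quotient.mk _ (linForm c)
  deg_pos := one_pos
  mem := ⟨_, isHomogeneous_linForm c, rfl⟩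

theorem linClass_ne_zero {c : Vec K n} (hc : c ∉ perp L) : (linClass L c).elt ≠ 0 := by
  rw [linClass, Ne, Ideal.Quotient.eq_zero_iff_mem, linForm_mem_idealOf]
  exact hc

section Infinite

variable [Infinite K]

theorem faithfulSMul_polyAlgebra (hM : IsMinorMap L M) :
    let := hM.polyAlgebra
    FaithfulSMul (CoordRing L) (Poly K n) := by
  let := hM.polyAlgebra
  rw [faithfulSMul_iff_algebraMap_injective]
  exact (algebraMap_FRing_injective _).comp hM.coordEquiv.injective

/-- The image of the form of `a` is again a nonzero linear form, hence prime. It does not divide the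
image of the form of `b`: at a preimage of `v` the first vanishes and the second is one. -/
theorem pow_dvd_of_pow_dvd_mul (hM : IsMinorMap L M) {u v a b : Vec K n}
    (hc : LineCoords L u v a b) (F : Poly K n) (k m : ℕ)
    (h : subst M (linForm a) ^ k ∣ subst M (linForm b) ^ m * F) :
    subst M (linForm a) ^ k ∣ F := by
  obtain ⟨x, hx⟩ := hM.exists_eq hc.left_mem
  obtain ⟨y, hy⟩ := hM.exists_eq hc.right_mem
  have ha : -M a ≠ 0 := by
    intro h0
    have h1 := congrArg (MvPolynomial.eval x) (hM.subst_linForm a)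
    rw [eval_subst, eval_linForm, eval_linForm, hx, h0, zero_dotProduct, dotProduct_comm,
      hc.left_left] at h1
    exact one_ne_zero h1
  rw [hM.subst_linForm a] at h ⊢
  refine (prime_linForm ha).pow_dvd_of_dvd_mul_left k (fun h1 => ?_) h
  have h2 := (prime_linForm ha).dvd_of_dvd_pow h1
  rw [← hM.subst_linForm a] at h2
  obtain ⟨g, hg⟩ := h2
  have h3 := congrArg (MvPolynomial.eval y) hg
  rw [map_mul, eval_subst, eval_subst, hy, eval_linForm, eval_linForm, dotProduct_comm a,
    dotProduct_comm b, hc.right_left, hc.right_right, zero_mul] at h3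
  exact one_ne_zero h3

/-- The only delicate degree is `d = -1`, where `F` is a constant. A point of `Z` forces it to be
zero; for empty `Z` the constant one is an element that comes from no tuple. -/
theorem exists_dualForm_eq_of_mem_dualPart (hM : IsMinorMap L M) (hZ : Z.Nonempty) {d : ℤ}
    {F : Poly K n} (hF : F ∈ dualPart Z (perp L) (d + 1)) : ∃ f, F = dualForm M f := by
  rw [mem_dualPart_add_one] at hF
  rcases lt_trichotomy d (-1) with hd | rfl | hd
  · refine ⟨0, ?_⟩
    rw [(mem_homogeneousPart_of_neg (by omega)).mp hF.2.2, map_zero]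
  · obtain ⟨P, hP⟩ := hZ
    have h1 : F.IsHomogeneous 0 := hF.2.2
    rw [← MvPolynomial.totalDegree_zero_iff_isHomogeneous, MvPolynomial.totalDegree_eq_zero_iff_eq_C] at h1
    have h2 : MvPolynomial.eval 0 F = 0 := mem_idealOfPoints.mp hF.1 P hP 0 (zero_mem _)
    rw [h1, MvPolynomial.eval_C] at h2
    refine ⟨0, ?_⟩
    rw [h1, h2, map_zero, map_zero]
  · obtain ⟨m, rfl⟩ := Int.eq_ofNat_of_zero_le (show 0 ≤ d by omega)
    obtain ⟨f, -, hf⟩ := hM.exists_dualForm_eq hF.2.1 hF.2.2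
    exact ⟨f, hf.symm⟩

end Infinite

/-- Combines the gluing criterion with its three inputs: forms vanish only on torsion classes, two
linear forms on `L` become coprime in `R`, and elements of the dual pieces come locally from
derivations. -/
theorem exists_restrictedDer_embedding [IsAlgClosed K] (hM : IsMinorMap L M)
    (hL : Module.finrank K L = 2) (hT : IsTransversal Z L) (hZ : Z.Finite) :
    letI := hM.polyAlgebra
    ∃ Ψ : RestrictedDer (dualArrangement Z) L →ₗ[CoordRing L] Poly K n,
      Function.Injective Ψ ∧
      (∀ (σ : RestrictedDer (dualArrangement Z) L) (p : PosHomogeneous (coordRingPart L))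
        (g : Poly K n) (θ : arrDer (dualArrangement Z)) (k : ℕ), p.elt ≠ 0 →
        Ideal.Quotient.mk (idealOf L) g = p.elt →
        σ.1 p = LocalizedModule.mk (derClass (dualArrangement Z) L θ) (Submonoid.pow p.elt k) →
        subst M g ^ k * Ψ σ = derForm M θ.1) ∧
      ∀ (d : ℤ) (F : Poly K n), F ∈ dualPart Z (perp L) (d + 1) →
        ∃ σ ∈ restrictedDerPart (dualArrangement Z) L d, Ψ σ = F := by
  let := hM.polyAlgebra
  have := hM.faithfulSMul_polyAlgebra
  have halg : ∀ f, algebraMap (CoordRing L) (Poly K n) (Ideal.Quotient.mk _ f) = subst M f :=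
    hM.algebraMap_coordEquiv_mk
  obtain ⟨ψ, hψ⟩ := hM.exists_derForm_linearMap (𝒜 := dualArrangement Z)
  obtain ⟨u, v, a, b, hc⟩ := exists_lineCoords hL
  have hzero : ∀ d, (0 : RedDerMod (dualArrangement Z) L) ∈ redDerModPart (dualArrangement Z) L d :=
    fun d => ⟨0, fun i => zero_mem _, (derClassHom (dualArrangement Z) L).map_zero⟩
  have htors : ∀ p : PosHomogeneous (coordRingPart L), p.elt ≠ 0 →
      ∀ x, ψ x = 0 → ∃ c : ℕ, p.elt ^ c • x = 0 := by
    intro p _ x hx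
    obtain ⟨θ, rfl⟩ := derClassHom_surjective x
    obtain ⟨g, hg, hgp⟩ := p.mem
    rw [← hgp]
    exact hM.exists_pow_smul_derClassHom_eq_zero hL hT hZ ((hψ θ).symm.trans hx) p.deg_pos hg
  have hcop : ∀ (F : Poly K n) (k m : ℕ),
      algebraMap (CoordRing L) (Poly K n) (linClass L a).elt ^ k ∣
        algebraMap (CoordRing L) (Poly K n) (linClass L b).elt ^ m * F →
      algebraMap (CoordRing L) (Poly K n) (linClass L a).elt ^ k ∣ F := by
    rw [linClass, linClass, halg, halg]
    exact hM.pow_dvd_of_pow_dvd_mul hc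
  obtain ⟨Ψ, hΨinj, hΨ, hΨsurj⟩ := exists_sectionModule_embedding ψ hzero htors
    (linClass L a) (linClass L b) (linClass_ne_zero hc.left_notMem)
    (linClass_ne_zero hc.right_notMem) hcop
  refine ⟨Ψ, hΨinj, fun σ p g θ k hp hg hσ => ?_, fun d F hF => hΨsurj d F fun r _ => ?_⟩
  · have h1 := hΨ σ p hp _ k hσ
    rwa [hψ, ← hg, halg] at h1
  · obtain ⟨g, hg, hgr⟩ := r.mem
    obtain ⟨k, θ, hθ, hθF⟩ := hM.exists_derForm_eq_pow_mul hL hT hZ hF r.deg_pos hg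
    refine ⟨k, derClass (dualArrangement Z) L θ, ⟨θ, hθ, rfl⟩, ?_⟩
    rw [hψ, hθF, ← hgr, halg]

section Values

variable [Infinite K] {Ψ : RestrictedDer (dualArrangement Z) L → Poly K n}

theorem value_mem_dualPart (hM : IsMinorMap L M) (hL : Module.finrank K L = 2)
    (hT : IsTransversal Z L)
    (hΨ : ∀ (σ : RestrictedDer (dualArrangement Z) L) (p : PosHomogeneous (coordRingPart L))
      (g : Poly K n) (θ : arrDer (dualArrangement Z)) (k : ℕ), p.elt ≠ 0 →
      Ideal.Quotient.mk (idealOf L) g = p.elt →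
      σ.1 p = LocalizedModule.mk (derClass (dualArrangement Z) L θ) (Submonoid.pow p.elt k) →
      subst M g ^ k * Ψ σ = derForm M θ.1) {d : ℤ} {σ : RestrictedDer (dualArrangement Z) L}
    (hσ : σ ∈ restrictedDerPart (dualArrangement Z) L d) :
    Ψ σ ∈ dualPart Z (perp L) (d + 1) := by
  refine hM.mem_dualPart_of_forall hL hT fun c hc => ?_
  obtain ⟨k, x, ⟨θ, hθ, rfl⟩, hk⟩ := hσ.1 (linClass L c)
  refine ⟨k, ?_⟩
  rw [hΨ σ _ (linForm c) θ k (linClass_ne_zero hc) rfl hk]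
  have h2 := hM.derForm_mem_dualPart θ hθ
  rwa [show ((linClass L c).deg : ℤ) = 1 from rfl, mul_one] at h2

/-- One chart suffices. There `θ` and a multiple of `δ` agree up to an Euler term after
multiplication by a power of the form of `a`; the form of the Euler term is zero, and the power
cancels in the domain `R`. -/
theorem value_eq_of_isClassOf (hM : IsMinorMap L M) (hL : Module.finrank K L = 2)
    (hΨ : ∀ (σ : RestrictedDer (dualArrangement Z) L) (p : PosHomogeneous (coordRingPart L))
      (g : Poly K n) (θ : arrDer (dualArrangement Z)) (k : ℕ), p.elt ≠ 0 →
      Ideal.Quotient.mk (idealOf L) g = p.elt →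
      σ.1 p = LocalizedModule.mk (derClass (dualArrangement Z) L θ) (Submonoid.pow p.elt k) →
      subst M g ^ k * Ψ σ = derForm M θ.1) {σ : RestrictedDer (dualArrangement Z) L}
    {δ : Derivation K (Poly K n) (CoordRing L)} (hδ : IsClassOf σ δ) :
    Ψ σ = ∑ i, algebraMap (FRing (perp L)) (Poly K n)
      (hM.coordEquiv (δ (MvPolynomial.X i))) * MvPolynomial.X i := by
  obtain ⟨u, v, a, b, hc⟩ := exists_lineCoords hL
  obtain ⟨x, k, hx⟩ := exists_eq_mk _ (σ.1 (linClass L a))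
  obtain ⟨θ, rfl⟩ := derClassHom_surjective x
  obtain ⟨c, w, hcw⟩ := hδ (linClass L a) θ k hx
  obtain ⟨w, rfl⟩ := Ideal.Quotient.mk_surjective w
  choose f hf using fun i => Ideal.Quotient.mk_surjective (δ (MvPolynomial.X i))
  have h1 := hΨ σ _ (linForm a) θ k (linClass_ne_zero hc.left_notMem) rfl hx
  have hp : subst M (linForm a) ≠ 0 := by
    rw [Ne, subst_eq_zero_iff hM.range_eq, linForm_mem_idealOf]
    exact hc.left_notMem
  have hsum : ∑ i, algebraMap (FRing (perp L)) (Poly K n)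
      (hM.coordEquiv (δ (MvPolynomial.X i))) * MvPolynomial.X i = dualForm M f := by
    rw [dualForm_apply]
    refine Finset.sum_congr rfl fun i _ => ?_
    rw [← hf i, hM.algebraMap_coordEquiv_mk]
  rw [hsum]
  have h2 : ∀ i, linForm a ^ c * θ.1 (MvPolynomial.X i) -
      (linForm a ^ (c + k) * f i + w * MvPolynomial.X i) ∈ idealOf L := by
    intro i
    have h3 := hcw (MvPolynomial.X i)
    rw [← hf i, euler_X] at h3
    rw [← Ideal.Quotient.mk_eq_mk_iff_sub_mem, map_mul, map_add, map_mul, map_mul, map_pow,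
      map_pow]
    exact h3
  have h3 := hM.dualForm_eq_zero_of_mem h2
  have h4 : dualForm M (linForm a ^ c • (fun i => θ.1 (MvPolynomial.X i)) -
      (linForm a ^ (c + k) • f + w • MvPolynomial.X)) = 0 := h3
  rw [map_sub, map_add, dualForm_smul, dualForm_smul, dualForm_smul, hM.dualForm_X, mul_zero,
    add_zero, ← derForm_apply, ← h1, map_pow, map_pow, ← mul_assoc, ← pow_add, ← mul_sub] at h4
  exact sub_eq_zero.mp ((mul_eq_zero.mp h4).resolve_left (pow_ne_zero _ hp))

/-- The tuple `f` defines the derivation. On each chart its difference from a local representative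
has zero form, hence is an Euler multiple modulo `I(L)`. -/
theorem exists_isClassOf (hM : IsMinorMap L M) (hL : Module.finrank K L = 2)
    (hΨ : ∀ (σ : RestrictedDer (dualArrangement Z) L) (p : PosHomogeneous (coordRingPart L))
      (g : Poly K n) (θ : arrDer (dualArrangement Z)) (k : ℕ), p.elt ≠ 0 →
      Ideal.Quotient.mk (idealOf L) g = p.elt →
      σ.1 p = LocalizedModule.mk (derClass (dualArrangement Z) L θ) (Submonoid.pow p.elt k) →
      subst M g ^ k * Ψ σ = derForm M θ.1) {σ : RestrictedDer (dualArrangement Z) L}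
    {f : Fin (n + 2) → Poly K n} (hf : Ψ σ = dualForm M f) : ∃ δ, IsClassOf σ δ := by
  let D : Derivation K (Poly K n) (Poly K n) := MvPolynomial.mkDerivation K f
  refine ⟨(Algebra.linearMap (Poly K n) (CoordRing L)).compDer D, ?_⟩
  intro p θ k hσ
  by_cases hp : p.elt = 0
  -- At the index zero, a positive exponent makes both sides vanish.
  · refine ⟨1, 0, fun q => ?_⟩
    rw [hp, zero_pow (by omega), zero_pow (by omega), zero_mul, zero_mul, zero_mul, add_zero]
  obtain ⟨g, -, hgp⟩ := p.mem
  have h1 := hΨ σ p g θ k hp hgp hσ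
  rw [hf, ← map_pow, ← dualForm_smul, eq_comm, derForm_apply, ← sub_eq_zero, ← map_sub] at h1
  obtain ⟨w, hw⟩ := hM.exists_of_dualForm_eq_zero hL h1
  refine ⟨0, Ideal.Quotient.mk _ w, fun q => ?_⟩
  have h2 : (θ.1 - (g ^ k • D + w • euler K n)) q ∈ idealOf L := by
    rw [eq_sum_constDer (θ.1 - (g ^ k • D + w • euler K n)), sum_derivation_apply]
    refine sum_mem fun i _ => Ideal.mul_mem_right _ _ ?_
    have h4 := hw i
    rw [Derivation.sub_apply, Derivation.add_apply, Derivation.smul_apply, Derivation.smul_apply,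
      euler_X, MvPolynomial.mkDerivation_X, ← sub_sub]
    exact h4
  rw [Derivation.sub_apply, ← Ideal.Quotient.mk_eq_mk_iff_sub_mem, Derivation.add_apply,
    Derivation.smul_apply, Derivation.smul_apply, smul_eq_mul, smul_eq_mul, map_add, map_mul,
    map_mul, map_pow, hgp] at h2
  rw [pow_zero, one_mul, zero_add]
  exact h2

end Values

end IsMinorMap

/-! ### Base change along the isomorphism of coordinate rings -/

section TensorProduct

variable {A B M R : Type*} [CommRing A] [CommRing B] [Algebra A B] [AddCommGroup M] [Module A M]
  [AddCommGroup R] [Module A R] [Module B R] [IsScalarTower A B R]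

/-- An injective linear map over `A` induces an isomorphism from the base change along a surjection
`A → B` to any `B`-submodule that is spanned by images and contains all of them. -/
theorem exists_baseChange_equiv (hAB : Function.Surjective (algebraMap A B)) (Ψ : M →ₗ[A] R)
    (hΨ : Function.Injective Ψ) (T : Submodule B R) (hT : ∀ m, Ψ m ∈ T)
    (hT' : T ≤ Submodule.span B (Set.range Ψ)) :
    ∃ η : (B ⊗[A] M) ≃ₗ[B] T, ∀ (a : B) (m : M), (η (a ⊗ₜ m) : R) = a • Ψ m := by
  let η₀ : (B ⊗[A] M) →ₗ[B] R := Ψ.liftBaseChange B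
  have hη₀ : ∀ (a : B) (m : M), η₀ (a ⊗ₜ m) = a • Ψ m := fun a m =>
    LinearMap.liftBaseChange_tmul B Ψ a m
  -- Surjectivity of `A → B` moves every scalar to the right factor, so injectivity and image can be
  -- read off from `Ψ`.
  have hone : ∀ x : B ⊗[A] M, ∃ m, x = 1 ⊗ₜ m := by
    intro x
    induction x using TensorProduct.induction_on with
    | zero => exact ⟨0, by simp⟩
    | tmul b m =>
      obtain ⟨a, rfl⟩ := hAB b
      refine ⟨a • m, ?_⟩
      rw [TensorProduct.tmul_smul, TensorProduct.smul_tmul', Algebra.smul_def, mul_one]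
    | add x y hx hy =>
      obtain ⟨m, rfl⟩ := hx
      obtain ⟨m', rfl⟩ := hy
      exact ⟨m + m', (TensorProduct.tmul_add _ _ _).symm⟩
  have hmem : ∀ x, η₀ x ∈ T := by
    intro x
    obtain ⟨m, rfl⟩ := hone x
    rw [hη₀, one_smul]
    exact hT m
  refine ⟨LinearEquiv.ofBijective (η₀.codRestrict T hmem) ⟨?_, ?_⟩, hη₀⟩
  · rw [injective_iff_map_eq_zero]
    intro x hx
    obtain ⟨m, rfl⟩ := hone x
    have h1 : η₀ (1 ⊗ₜ m) = 0 := congrArg Subtype.val hx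
    rw [hη₀, one_smul, map_eq_zero_iff _ hΨ] at h1
    rw [h1, TensorProduct.tmul_zero]
  · rintro ⟨y, hy⟩
    have h1 : Submodule.span B (Set.range Ψ) ≤ LinearMap.range η₀ := by
      rw [Submodule.span_le]
      rintro _ ⟨m, rfl⟩
      exact ⟨1 ⊗ₜ m, by rw [hη₀, one_smul]⟩
    obtain ⟨x, hx⟩ := h1 (hT' hy)
    exact ⟨x, Subtype.ext hx⟩

end TensorProduct

section TensorPart

variable {K : Type*} [Field K] {n : ℕ} {Z : Set (ℙ K (Vec K n))}
  {L Q : Submodule K (Vec K n)} [Algebra (CoordRing L) (FRing Q)]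

theorem one_tmul_mem_tensorPart {𝒜 : Set (Submodule K (Vec K n))} {d : ℤ}
    {σ : RestrictedDer 𝒜 L} (hσ : σ ∈ restrictedDerPart 𝒜 L d) :
    (1 : FRing Q) ⊗ₜ[CoordRing L] σ ∈ tensorPart 𝒜 L Q d := by
  refine AddSubgroup.subset_closure ⟨0, d, 1, σ, by simp, ?_, hσ, rfl⟩
  rw [fRingPart, pow_zero]
  exact Submodule.one_le.mp le_rfl

/-- A linear map that sends the sections of degree `d` to forms of degree `d + 1` does so on the
base change to `ℱ_Q`. -/
theorem apply_mem_dualPart_of_mem_tensorPart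
    (η : (FRing Q ⊗[CoordRing L] RestrictedDer (dualArrangement Z) L) →ₗ[FRing Q] Poly K n)
    (hη : ∀ (d : ℤ), ∀ σ ∈ restrictedDerPart (dualArrangement Z) L d,
      η (1 ⊗ₜ σ) ∈ dualPart Z Q (d + 1)) {d : ℤ}
    {x : FRing Q ⊗[CoordRing L] RestrictedDer (dualArrangement Z) L}
    (hx : x ∈ tensorPart (dualArrangement Z) L Q d) : η x ∈ dualPart Z Q (d + 1) := by
  refine AddSubgroup.closure_induction (p := fun x _ => η x ∈ dualPart Z Q (d + 1)) ?_ ?_ ?_ ?_ hx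
  · rintro _ ⟨i, j, a, σ, rfl, ha, hσ, rfl⟩
    have h1 : a ⊗ₜ[CoordRing L] σ = a • ((1 : FRing Q) ⊗ₜ[CoordRing L] σ) := by
      rw [TensorProduct.smul_tmul', smul_eq_mul, mul_one]
    rw [h1, map_smul, Algebra.smul_def]
    have ha' := algebraMap_mem_of_mem_fRingPart _ ha
    exact mul_mem_dualPart ha'.1 ha'.2 (hη j σ hσ)
  · rw [map_zero]; exact zero_mem _
  · intro x y _ _ hx hy
    rw [map_add]; exact add_mem hx hy
  · intro x _ hx
    rw [map_neg]; exact neg_mem hx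

end TensorPart

/-! ### Assembly of the isomorphism -/

namespace IsMinorMap

variable {K : Type*} [Field K] {n : ℕ} {Z : Set (ℙ K (Vec K n))}
  {L : Submodule K (Vec K n)} {M : Vec K n →ₗ[K] Vec K n}

/-- The isomorphism between the base change of `D₀(𝒜_Z)|_L` and `I_Q^≫(Z)`. -/
theorem exists_dualEquiv [IsAlgClosed K] (hM : IsMinorMap L M)
    (hL : Module.finrank K L = 2) (hT : IsTransversal Z L) (hZ : Z.Finite) :
    letI : Algebra (CoordRing L) (FRing (perp L)) :=
      (hM.coordEquiv : CoordRing L →+* FRing (perp L)).toAlgebra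
    ∃ η : (FRing (perp L) ⊗[CoordRing L] RestrictedDer (dualArrangement Z) L)
        ≃ₗ[FRing (perp L)] dualModule Z (perp L),
      (∀ (σ : RestrictedDer (dualArrangement Z) L)
        (δ : Derivation K (Poly K n) (CoordRing L)), IsClassOf σ δ →
        (η (1 ⊗ₜ σ) : Poly K n) = ∑ i, algebraMap (FRing (perp L)) (Poly K n)
          (hM.coordEquiv (δ (MvPolynomial.X i))) * MvPolynomial.X i) ∧
      (Z.Nonempty → ∀ σ : RestrictedDer (dualArrangement Z) L, ∃ δ, IsClassOf σ δ) ∧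
      (∀ d : ℤ, (fun x => (η x : Poly K n)) '' (tensorPart (dualArrangement Z) L (perp L) d)
        = dualPart Z (perp L) (d + 1)) ∧
      (∀ d : ℤ, Set.BijOn (fun σ => (η (1 ⊗ₜ σ) : Poly K n))
        (restrictedDerPart (dualArrangement Z) L d) (dualPart Z (perp L) (d + 1))) ∧
      (∀ d : ℤ, {F | F ∈ dualModule Z (perp L) ∧ F ∈ homogeneousPart d}
        = (dualPart Z (perp L) d : Set (Poly K n))) := by
  let : Algebra (CoordRing L) (FRing (perp L)) :=
    (hM.coordEquiv : CoordRing L →+* FRing (perp L)).toAlgebra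
  let := hM.polyAlgebra
  have : IsScalarTower (CoordRing L) (FRing (perp L)) (Poly K n) :=
    IsScalarTower.of_algebraMap_eq fun _ => rfl
  obtain ⟨Ψ, hΨinj, hΨ, hΨsurj⟩ := hM.exists_restrictedDer_embedding hL hT hZ
  have hmaps : ∀ {d : ℤ} {σ : RestrictedDer (dualArrangement Z) L},
      σ ∈ restrictedDerPart (dualArrangement Z) L d → Ψ σ ∈ dualPart Z (perp L) (d + 1) :=
    fun hσ => hM.value_mem_dualPart hL hT hΨ hσ
  -- The section module is spanned by homogeneous sections, so a property of values closed under
  -- sums and scalars has to be checked only on the graded pieces.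
  have hind : ∀ (p : Poly K n → Prop), (∀ (d : ℤ), ∀ F ∈ dualPart Z (perp L) (d + 1), p F) →
      p 0 → (∀ F G, p F → p G → p (F + G)) → (∀ (r : CoordRing L) F, p F → p (r • F)) →
      ∀ σ, p (Ψ σ) := by
    rintro p h1 h2 h3 h4 ⟨σ, hσ⟩
    refine Submodule.span_induction (p := fun x hx => p (Ψ ⟨x, hx⟩)) ?_ ?_ ?_ ?_ hσ
    · intro x hx
      obtain ⟨d, hd⟩ := Set.mem_iUnion.mp hx
      exact h1 d _ (hmaps hd)
    · exact (map_zero Ψ).symm ▸ h2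
    · intro x y hx hy ihx ihy
      exact (map_add Ψ ⟨x, hx⟩ ⟨y, hy⟩).symm ▸ h3 _ _ ihx ihy
    · intro r x hx ih
      exact (map_smul Ψ r ⟨x, hx⟩).symm ▸ h4 r _ ih
  have hmem : ∀ σ, Ψ σ ∈ dualModule Z (perp L) := by
    refine hind _ (fun d F hF => dualPart_le_dualModule _ _ hF) (zero_mem _)
      (fun F G hF hG => add_mem hF hG) fun r F hF => ?_
    rw [← algebraMap_smul (FRing (perp L)) r F]
    exact Submodule.smul_mem _ _ hF
  have hspan : dualModule Z (perp L) ≤ Submodule.span (FRing (perp L)) (Set.range Ψ) := by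
    refine Submodule.span_le.mpr (Set.iUnion_subset fun d F hF => ?_)
    rw [← sub_add_cancel d 1] at hF
    obtain ⟨σ, -, hσ⟩ := hΨsurj _ F hF
    exact Submodule.subset_span ⟨σ, hσ⟩
  obtain ⟨η, hη⟩ := exists_baseChange_equiv (A := CoordRing L) (B := FRing (perp L))
    hM.coordEquiv.surjective Ψ hΨinj _ hmem hspan
  have hη1 : ∀ σ, (η (1 ⊗ₜ σ) : Poly K n) = Ψ σ := fun σ => by rw [hη, one_smul]
  refine ⟨η, fun σ δ hδ => ?_, fun hne σ => ?_, fun d => ?_, fun d => ?_,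
    dualModule_inter_homogeneousPart _⟩
  · rw [hη1]
    exact hM.value_eq_of_isClassOf hL hΨ hδ
  · obtain ⟨f, hf⟩ : ∃ f, Ψ σ = dualForm M f := by
      refine hind (fun F => ∃ f, F = dualForm M f)
        (fun d F hF => hM.exists_dualForm_eq_of_mem_dualPart hne hF) ⟨0, (map_zero _).symm⟩
        ?_ ?_ σ
      · rintro _ _ ⟨f, rfl⟩ ⟨g, rfl⟩
        exact ⟨f + g, (map_add _ _ _).symm⟩
      · rintro r _ ⟨f, rfl⟩
        obtain ⟨s, rfl⟩ := Ideal.Quotient.mk_surjective r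
        exact ⟨s • f, (hM.polyAlgebra_smul s _).trans (dualForm_smul M s f).symm⟩
    exact hM.exists_isClassOf hL hΨ hf
  · refine Set.Subset.antisymm ?_ fun F hF => ?_
    · rintro _ ⟨x, hx, rfl⟩
      exact apply_mem_dualPart_of_mem_tensorPart
        ((dualModule Z (perp L)).subtype ∘ₗ η.toLinearMap)
        (fun d σ hσ => by
          change (η (1 ⊗ₜ σ) : Poly K n) ∈ _
          rw [hη1]
          exact hmaps hσ) hx
    · obtain ⟨σ, hσ, hσF⟩ := hΨsurj d F hF
      exact ⟨1 ⊗ₜ σ, one_tmul_mem_tensorPart hσ, (hη1 σ).trans hσF⟩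
  · have h : (fun σ => (η (1 ⊗ₜ σ) : Poly K n)) = Ψ := funext hη1
    rw [h]
    exact ⟨fun σ hσ => hmaps hσ, hΨinj.injOn, fun F hF => hΨsurj d F hF⟩

end IsMinorMap

end PointsAndDerivations

end

open PointsAndDerivations in
theorem theorem4p14 {K : Type*} [Field K] [IsAlgClosed K] (n : ℕ)
    (Z : Set (ℙ K (Vec K n))) (hZ : Z.Finite) :
    HoldsForGeneralLine fun L : Submodule K (Vec K n) =>
      ∀ α : Fin n → Vec K n, Submodule.span K (Set.range α) = perp L →
      -- the isomorphism `τ_Q : S/I(L) ≅ ℱ_Q`, for `Q = L^⊥` with basis `α`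
      ∃ τ : CoordRing L ≃ₐ[K] FRing (perp L),
        (∀ i, algebraMap (FRing (perp L)) (Poly K n)
          (τ (Ideal.Quotient.mk (idealOf L) (MvPolynomial.X i))) = minor α i) ∧
        letI : Algebra (CoordRing L) (FRing (perp L)) :=
          (τ : CoordRing L →+* FRing (perp L)).toAlgebra
        -- the isomorphism `η_Q` of `ℱ_Q`-modules
        ∃ η : (FRing (perp L) ⊗[CoordRing L] RestrictedDer (dualArrangement Z) L)
            ≃ₗ[FRing (perp L)] dualModule Z (perp L),
          (∀ (σ : RestrictedDer (dualArrangement Z) L)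
            (δ : Derivation K (Poly K n) (CoordRing L)), IsClassOf σ δ →
            (η (1 ⊗ₜ σ) : Poly K n) = ∑ i, algebraMap (FRing (perp L)) (Poly K n)
              (τ (δ (MvPolynomial.X i))) * MvPolynomial.X i) ∧
          (Z.Nonempty → ∀ σ : RestrictedDer (dualArrangement Z) L, ∃ δ, IsClassOf σ δ) ∧
          -- it is homogeneous, and shifts degrees by one
          (∀ d : ℤ, (fun x => (η x : Poly K n)) '' (tensorPart (dualArrangement Z) L (perp L) d)
            = dualPart Z (perp L) (d + 1)) ∧
          (∀ d : ℤ, Set.BijOn (fun σ => (η (1 ⊗ₜ σ) : Poly K n))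
            (restrictedDerPart (dualArrangement Z) L d) (dualPart Z (perp L) (d + 1))) ∧
          -- the graded pieces of the target
          (∀ d : ℤ, {F | F ∈ dualModule Z (perp L) ∧ F ∈ homogeneousPart d}
            = (dualPart Z (perp L) d : Set (Poly K n))) := by
  refine holdsForGeneralLine_of_isTransversal hZ fun L hL hT α hα => ?_
  have hM := isMinorMap_minorMap hL hα
  exact ⟨hM.coordEquiv,
    fun i => (hM.algebraMap_coordEquiv_mk _).trans (subst_minorMap_X α i),
    hM.exists_dualEquiv hL hT hZ⟩
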